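/- For a positive integer $n$ put $\varpi(n)=\log n$ if $n$ is prime and $\varpi(n)=0$ otherwise, and for real $y\ge 0$ and integers $q\ge 1$ and $a$ put $$\vartheta^*(y;a,q)=\sum_{\substack{y<n\le 2y\\ n\equiv a\ (\mathrm{mod}\ q)}}\varpi(n).$$ Call a finite set $\mathcal H$ of integers admissible if, for every prime $p$, the integers $-h$ ($h\in\mathcal H$) occupy fewer than $p$ residue classes modulo $p$; an admissible $7$-tuple is an admissible set of $7$ distinct integers. Theorem. Suppose that for some real $\theta$ with $20/21<\theta<1$ one has, for every fixed $A>0$, $$\sum_{q\le x^{\theta}}\ \max_{0\le y\le x}\ \max_{(a,q)=1}\left|\vartheta^*(y;a,q)-\frac{y}{\varphi(q)}\right|\ \ll_A\ \frac{x}{(\log x)^A}\qquad(x\to\infty),$$ where $x$ and $y$ are real, $\max_y$ is understood as a supremum, and the implied constant depends only on $A$ (and $\theta$). Then: (i) for every admissible $7$-tuple $\mathcal H$ there are infinitely many positive integers $n$ such that at least two of the seven numbers $n+h$, $h\in\mathcal H$, are prime; (ii) in particular, $\{0,2,6,8,12,18,20\}$ is admissible, so at least two of $n,\ n+2,\ n+6,\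 n+8,\ n+12,\ n+18,\ n+20$ are prime for infinitely many $n$; (iii) consequently $p_{n+1}-p_n\le 20$ for infinitely many $n$, where $p_n$ denotes the $n$-th prime. -/

import Mathlib

namespace SmallGaps

/-- The prime indicator with logarithmic weight: `log n` if `n` is a prime, and `0` otherwise. -/
noncomputable def varpi (n : ℕ) : ℝ :=
  if n.Prime then Real.log n else 0

/-- The sum of `varpi n` over `y < n ≤ 2y` with `n ≡ a (mod q)` (for real `y ≥ 0`). -/
noncomputable def thetaStar (y : ℝ) (a q : ℕ) : ℝ :=
  ∑ n ∈ (Finset.Ioc ⌊y⌋₊ ⌊2 * y⌋₊).filter (fun n => n ≡ a [MOD q]), varpi n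

/-- The errors `|ϑ*(y; a, q) - y / φ(q)|` for real `0 ≤ y ≤ x` and `a` coprime to `q`. -/
def errorSet (x : ℝ) (q : ℕ) : Set ℝ :=
  {e | ∃ y : ℝ, 0 ≤ y ∧ y ≤ x ∧ ∃ a : ℕ, a.Coprime q ∧
    e = |thetaStar y a q - y / (Nat.totient q : ℝ)|}

/-- The largest error, `max_{y ≤ x} max_{(a, q) = 1} |ϑ*(y; a, q) - y / φ(q)|`. The supremum is
a genuine one, by `errorSet_nonempty` and `errorSet_bddAbove`. -/
noncomputable def maxError (x : ℝ) (q : ℕ) : ℝ :=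
  sSup (errorSet x q)

theorem varpi_nonneg (n : ℕ) : 0 ≤ varpi n := by
  unfold varpi
  split_ifs
  · exact Real.log_natCast_nonneg n
  · exact le_rfl

theorem errorSet_nonempty {x : ℝ} (hx : 0 ≤ x) (q : ℕ) : (errorSet x q).Nonempty :=
  ⟨_, 0, le_rfl, hx, 1, Nat.coprime_one_left q, rfl⟩

theorem errorSet_bddAbove (x : ℝ) (q : ℕ) : BddAbove (errorSet x q) := by
  refine ⟨(∑ n ∈ Finset.Ioc 0 ⌊2 * x⌋₊, varpi n) + x / (Nat.totient q : ℝ), ?_⟩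
  rintro e ⟨y, hy0, hyx, a, -, rfl⟩
  have h1 : 0 ≤ thetaStar y a q := Finset.sum_nonneg fun n _ => varpi_nonneg n
  have h2 : thetaStar y a q ≤ ∑ n ∈ Finset.Ioc 0 ⌊2 * x⌋₊, varpi n := by
    refine Finset.sum_le_sum_of_subset_of_nonneg ?_ fun n _ _ => varpi_nonneg n
    refine (Finset.filter_subset _ _).trans ?_
    exact Finset.Ioc_subset_Ioc (Nat.zero_le _) (Nat.floor_mono (by linarith))
  have h3 : 0 ≤ y / (Nat.totient q : ℝ) := by positivity
  have h4 : y / (Nat.totient q : ℝ) ≤ x / (Nat.totient q : ℝ) := by gcongr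
  rw [abs_le]
  constructor <;> linarith

/-- The primes have level of distribution `θ`: for every fixed real `A > 0`,
`∑_{q ≤ x^θ} max_{y ≤ x} max_{(a, q) = 1} |ϑ*(y; a, q) - y / φ(q)| ≪_A x / (log x)^A`. -/
def LevelOfDistribution (θ : ℝ) : Prop :=
  ∀ A : ℝ, 0 < A →
    (fun x : ℝ => ∑ q ∈ Finset.Icc 1 ⌊x ^ θ⌋₊, maxError x q)
      =O[Filter.atTop] fun x : ℝ => x / Real.log x ^ A

/-- The residue classes modulo `p` among the `-h`, `h ∈ H`. -/
def Omega (H : Finset ℤ) (p : ℕ) : Finset (ZMod p) :=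
  H.image fun h => ((-h : ℤ) : ZMod p)

/-- `H` is admissible: `|Ω(p)| < p` for all primes `p`. -/
def Admissible (H : Finset ℤ) : Prop :=
  ∀ p : ℕ, p.Prime → (Omega H p).card < p

/-- The number of `h ∈ H` such that `n + h` is a prime (a positive one: for `n + h ≤ 0` the
value of `Int.toNat` is `0`, which is not a prime). -/
def primeCount (H : Finset ℤ) (n : ℕ) : ℕ :=
  (H.filter fun h => ((n : ℤ) + h).toNat.Prime).card

end SmallGaps

/-!
This is the method of Goldston, Pintz and Yıldırım, in an elementary form. Let `k` be the number of
shifts. Fix a large `D`, let `W` be the product of the primes up to `D`, and restrict `n` to a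
residue class modulo `W` in which every `n + h` is coprime to `W`. For real weights `λ` supported
on products of distinct primes in `(D, R]` consider the nonnegative weight
`(∑ λ(d)) ^ 2`, summed over the `d` dividing `∏ (n + h)`. If no `n` in a long interval
`(N - C, 2 N + C]` gave two primes, then
`∑ₕ ∑ₙ varpi (n + h) (∑ λ(d)) ^ 2 ≤ log (2 N) ∑ₙ (∑ λ(d)) ^ 2`,
where the sum over primes is restricted to `N < n + h ≤ 2 N` (`sum_primeWeight_le`). Both sides are
quadratic forms in `λ` up to errors, which are controlled by the level of distribution when
`R ^ 2 ≤ N ^ θ'` for some `θ' < θ` (`error_integers_le`, `error_primes_le`).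

A squarefree number is represented throughout by its set of prime factors, so that least common
multiples become unions. Selberg's change of variables diagonalises the form of the right side,
with new variables `y` (`quadForm_integers`); here `y(d) = log (R / d)`. In these variables the
form of the left side is the sum over `r` of squares of `∑ y(r s) / φ(s)`, taken over `s` coprime to
`r W` (`quadForm_primes`). The classical inequality
`∑ μ(s) ^ 2 / φ(s) ≥ (φ(q) / q) log x`, over `s ≤ x` coprime to `q`, in a form weighted by
`log (x / s)`, bounds it from below without any loss
(`prod_mul_sq_posPart_le_sum_ell`).

Both forms are then compared with the moments `M j`, which are sums of `log (R / d) ^ j` over `d`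
with density `k - 1` (`sieveMoment`). The left side is at least a constant times `k M 4 / 4`, the
right side at most the same constant times `log N (M 3 / 3 + O(M 2))`, up to a factor close to `1`
for large `D` (`sum_prod_mul_ell_sq_le_sieveMoment`). No asymptotic formula for `M j` is needed:
Mertens' upper bound for `∑ log p / p` gives `M (j + 1) ≥ (j + 1) / (j + k) (log R - O(1)) M j`
(`exists_sieveMoment_succ_ge`). With `log R = (θ' / 2) log N` the two sides contradict each other
when `3 k θ' > 2 (k + 3)`, which for `k = 7` is `θ' > 20 / 21`.
-/

namespace SmallGaps

open Finset

/-! ### Sums over subsets and Selberg's diagonalisation -/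

section PowersetSums

variable {ι : Type*} [DecidableEq ι]

theorem sum_powerset_superset (P V : Finset ι) (hV : V ⊆ P) (F : Finset ι → ℝ) :
    ∑ S ∈ P.powerset with V ⊆ S, F S = ∑ S ∈ (P \ V).powerset, F (V ∪ S) := by
  symm
  refine Finset.sum_bij' (fun S _ => V ∪ S) (fun S _ => S \ V) ?_ ?_ ?_ ?_ ?_
  · intro S hS
    rw [mem_powerset, subset_sdiff] at hS
    simp [union_subset hV hS.1]
  · intro S hS
    rw [mem_filter, mem_powerset] at hS
    rw [mem_powerset]
    exact sdiff_subset_sdiff hS.1 subset_rfl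
  · intro S hS
    rw [mem_powerset, subset_sdiff] at hS
    rw [union_sdiff_left, sdiff_eq_self_of_disjoint hS.2]
  · intro S hS
    rw [mem_filter, mem_powerset] at hS
    exact union_sdiff_of_subset hS.2
  · intro S hS; rfl

theorem sum_powerset_comm (P : Finset ι) (F : Finset ι → Finset ι → ℝ) :
    ∑ S ∈ P.powerset, ∑ T ∈ (P \ S).powerset, F S (S ∪ T) =
      ∑ T ∈ P.powerset, ∑ S ∈ T.powerset, F S T := by
  have h1 : ∑ S ∈ P.powerset, ∑ T ∈ (P \ S).powerset, F S (S ∪ T) =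
      ∑ S ∈ P.powerset, ∑ T ∈ P.powerset with S ⊆ T, F S T :=
    sum_congr rfl fun S hS => (sum_powerset_superset P S (mem_powerset.1 hS) (F S)).symm
  rw [h1]
  refine Finset.sum_comm' fun S T => ?_
  simp only [mem_powerset, mem_filter]
  exact ⟨fun h => ⟨h.2.2, h.2.1⟩, fun h => ⟨h.1.trans h.2, h.2, h.1⟩⟩

theorem disjoint_of_mem_powerset_sdiff {P V S : Finset ι} (hS : S ∈ (P \ V).powerset) :
    Disjoint V S := by
  rw [mem_powerset, subset_sdiff] at hS
  exact hS.2.symm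

/-- Summing a product of sums `u + v` over subsets amounts to distributing the elements of each
subset between `u` and `v`. -/
theorem sum_powerset_prod_add (P : Finset ι) (u v : ι → ℝ) (F : Finset ι → ℝ) :
    ∑ T ∈ P.powerset, (∏ i ∈ T, (u i + v i)) * F T =
      ∑ S ∈ P.powerset, (∏ i ∈ S, u i) *
        ∑ T ∈ (P \ S).powerset, (∏ i ∈ T, v i) * F (S ∪ T) := by
  have h := sum_powerset_comm P fun S T => (∏ i ∈ S, u i) * ((∏ i ∈ T \ S, v i) * F T)
  calc _ = ∑ T ∈ P.powerset, ∑ S ∈ T.powerset,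
        (∏ i ∈ S, u i) * ((∏ i ∈ T \ S, v i) * F T) := by
        refine sum_congr rfl fun T _ => ?_
        rw [prod_add, sum_mul]
        exact sum_congr rfl fun S _ => by ring
    _ = _ := by
        rw [← h]
        refine sum_congr rfl fun S _ => ?_
        rw [mul_sum]
        refine sum_congr rfl fun T hT => ?_
        rw [union_sdiff_left, sdiff_eq_self_of_disjoint (disjoint_of_mem_powerset_sdiff hT).symm]

/-- Selberg's diagonalisation: with `f = 1 / g - 1`, the quadratic form `∑ λ(S) λ(T) g(S ∪ T)` is
a combination of squares. -/
theorem quadForm_eq_sum_sq (P : Finset ι) (g : ι → ℝ) (hg : ∀ i ∈ P, g i ≠ 0)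
    (lam : Finset ι → ℝ) :
    ∑ S ∈ P.powerset, ∑ T ∈ P.powerset, lam S * lam T * ∏ i ∈ S ∪ T, g i =
      ∑ V ∈ P.powerset, (∏ i ∈ V, ((g i)⁻¹ - 1)) *
        (∑ S ∈ (P \ V).powerset, lam (V ∪ S) * ∏ i ∈ V ∪ S, g i) ^ 2 := by
  -- `g (S ∪ T) = g S * g T / g (S ∩ T)`, and `1 / g` is the sum of `1 / g - 1` over subsets
  have key : ∀ S ∈ P.powerset, ∀ T ∈ P.powerset, ∏ i ∈ S ∪ T, g i =
      ∑ V ∈ P.powerset, (∏ i ∈ V, ((g i)⁻¹ - 1)) *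
        ((if V ⊆ S then ∏ i ∈ S, g i else 0) * (if V ⊆ T then ∏ i ∈ T, g i else 0)) := by
    intro S hS T hT
    rw [mem_powerset] at hS hT
    have h1 : (∏ i ∈ S ∪ T, g i) * ∏ i ∈ S ∩ T, g i = (∏ i ∈ S, g i) * ∏ i ∈ T, g i :=
      prod_union_inter
    have h2 : (∏ i ∈ S ∩ T, g i) * ∑ V ∈ (S ∩ T).powerset, ∏ i ∈ V, ((g i)⁻¹ - 1) = 1 := by
      rw [← prod_one_add, ← prod_mul_distrib]
      refine prod_eq_one fun i hi => ?_
      have := hg i (hS (mem_inter.1 hi).1)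
      field_simp
      ring
    have h3 : ∑ V ∈ P.powerset, (∏ i ∈ V, ((g i)⁻¹ - 1)) *
        ((if V ⊆ S then ∏ i ∈ S, g i else 0) * (if V ⊆ T then ∏ i ∈ T, g i else 0)) =
        (∑ V ∈ (S ∩ T).powerset, ∏ i ∈ V, ((g i)⁻¹ - 1)) *
          ((∏ i ∈ S, g i) * ∏ i ∈ T, g i) := by
      rw [sum_mul]
      symm
      refine sum_subset_zero_on_sdiff
        (powerset_mono.2 (inter_subset_left.trans hS)) ?_ ?_
      · intro V hV
        rw [mem_sdiff, mem_powerset, mem_powerset, subset_inter_iff, not_and_or] at hV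
        rcases hV.2 with h | h <;> simp [h]
      · intro V hV
        rw [mem_powerset, subset_inter_iff] at hV
        simp [hV.1, hV.2]
    rw [h3, ← h1, mul_comm, mul_assoc, h2, mul_one]
  have hsup : ∀ V ∈ P.powerset,
      ∑ S ∈ (P \ V).powerset, lam (V ∪ S) * ∏ i ∈ V ∪ S, g i =
      ∑ S ∈ P.powerset, lam S * (if V ⊆ S then ∏ i ∈ S, g i else 0) := by
    intro V hV
    rw [← sum_powerset_superset P V (mem_powerset.1 hV) fun S => lam S * ∏ i ∈ S, g i,
      sum_filter]
    exact sum_congr rfl fun S _ => by split_ifs <;> simp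
  calc _ = ∑ S ∈ P.powerset, ∑ T ∈ P.powerset, ∑ V ∈ P.powerset, lam S * lam T *
        ((∏ i ∈ V, ((g i)⁻¹ - 1)) *
        ((if V ⊆ S then ∏ i ∈ S, g i else 0) * (if V ⊆ T then ∏ i ∈ T, g i else 0))) := by
        refine sum_congr rfl fun S hS => sum_congr rfl fun T hT => ?_
        rw [key S hS T hT, mul_sum]
    _ = ∑ V ∈ P.powerset, ∑ S ∈ P.powerset, ∑ T ∈ P.powerset, lam S * lam T *
        ((∏ i ∈ V, ((g i)⁻¹ - 1)) *
        ((if V ⊆ S then ∏ i ∈ S, g i else 0) * (if V ⊆ T then ∏ i ∈ T, g i else 0))) := by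
        rw [sum_comm]
        rw [sum_congr rfl fun T _ => sum_comm, sum_comm]
        exact sum_congr rfl fun V _ => sum_comm
    _ = _ := by
        refine sum_congr rfl fun V hV => ?_
        rw [hsup V hV, sq, sum_mul_sum, mul_sum]
        refine sum_congr rfl fun S _ => ?_
        rw [mul_sum]
        exact sum_congr rfl fun T _ => by ring

/-- The sieve weights obtained from `y` by Selberg's change of variables
`λ(S) = c(S) ∑ w(T) y(T)`, the sum being over the `T ⊇ S`. For a density `g` one takes
`c = -1 / g` and `w = (1 / g - 1)⁻¹`. -/
noncomputable def selbergWeight (P : Finset ι) (c w : ι → ℝ) (y : Finset ι → ℝ) (S : Finset ι) :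
    ℝ :=
  (∏ i ∈ S, c i) * ∑ T ∈ (P \ S).powerset, (∏ i ∈ S ∪ T, w i) * y (S ∪ T)

/-- Möbius inversion on subsets, in the twisted form needed to evaluate one quadratic form in the
variables that diagonalise another. -/
theorem sum_selbergWeight_mul_prod (P V : Finset ι) (c w g : ι → ℝ)
    (y : Finset ι → ℝ) :
    ∑ S ∈ (P \ V).powerset, selbergWeight P c w y (V ∪ S) * ∏ i ∈ V ∪ S, g i =
      (∏ i ∈ V, c i * g i * w i) *
        ∑ T ∈ (P \ V).powerset, (∏ i ∈ T, w i * (1 + c i * g i)) * y (V ∪ T) := by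
  have h := sum_powerset_comm (P \ V) fun S T =>
    (∏ i ∈ V ∪ S, c i * g i) * ((∏ i ∈ V ∪ T, w i) * y (V ∪ T))
  calc _ = ∑ S ∈ (P \ V).powerset, ∑ T ∈ ((P \ V) \ S).powerset,
        (∏ i ∈ V ∪ S, c i * g i) * ((∏ i ∈ V ∪ (S ∪ T), w i) * y (V ∪ (S ∪ T))) := by
        refine sum_congr rfl fun S hS => ?_
        rw [selbergWeight, sdiff_sdiff_left, ← mul_sum, prod_mul_distrib]
        simp only [union_assoc, sup_eq_union]
        ring
    _ = _ := by
        rw [h, mul_sum]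
        refine sum_congr rfl fun T hT => ?_
        have hVT := disjoint_of_mem_powerset_sdiff hT
        rw [prod_mul_distrib (f := w), prod_one_add, mul_sum, sum_mul, mul_sum]
        refine sum_congr rfl fun S hS => ?_
        have hVS : Disjoint V S := hVT.mono_right (mem_powerset.1 hS)
        rw [prod_union hVS, prod_union hVT, prod_mul_distrib (f := fun i => c i * g i)]
        ring

/-- Bounding a sum over pairs of sets by one over their unions. -/
theorem sum_sum_union_le (P : Finset ι) (F : Finset ι → ℝ) (hF : ∀ U, 0 ≤ F U) :
    ∑ S ∈ P.powerset, ∑ T ∈ P.powerset, F (S ∪ T) ≤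
      ∑ U ∈ P.powerset, 4 ^ U.card * F U := by
  have h : ∀ S ∈ P.powerset, ∀ T ∈ P.powerset, F (S ∪ T) ≤
      ∑ U ∈ P.powerset, if S ⊆ U ∧ T ⊆ U then F U else 0 := by
    intro S hS T hT
    rw [mem_powerset] at hS hT
    have := single_le_sum (f := fun U => if S ⊆ U ∧ T ⊆ U then F U else 0)
      (fun U _ => by split_ifs <;> simp [hF]) (mem_powerset.2 (union_subset hS hT))
    simpa using this
  calc _ ≤ ∑ S ∈ P.powerset, ∑ T ∈ P.powerset,
        ∑ U ∈ P.powerset, if S ⊆ U ∧ T ⊆ U then F U else 0 :=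
        sum_le_sum fun S hS => sum_le_sum fun T hT => h S hS T hT
    _ = ∑ U ∈ P.powerset, ∑ S ∈ P.powerset,
        ∑ T ∈ P.powerset, if S ⊆ U ∧ T ⊆ U then F U else 0 := by
        rw [sum_congr rfl fun S _ => sum_comm, sum_comm]
    _ = _ := by
        refine sum_congr rfl fun U hU => ?_
        rw [mem_powerset] at hU
        have h1 : ∀ S ∈ P.powerset, (∑ T ∈ P.powerset, if S ⊆ U ∧ T ⊆ U then F U else 0) =
            if S ⊆ U then 2 ^ U.card * F U else 0 := by
          intro S _
          by_cases hS : S ⊆ U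
          · have : P.powerset.filter (· ⊆ U) = U.powerset := by
              ext T; simp only [mem_filter, mem_powerset]
              exact ⟨fun h => h.2, fun h => ⟨h.trans hU, h⟩⟩
            simp [hS, ← sum_filter, this]
          · simp [hS]
        rw [sum_congr rfl h1, ← sum_filter]
        have : P.powerset.filter (· ⊆ U) = U.powerset := by
          ext T; simp only [mem_filter, mem_powerset]
          exact ⟨fun h => h.2, fun h => ⟨h.trans hU, h⟩⟩
        rw [this, sum_const, card_powerset, nsmul_eq_mul]
        push_cast
        rw [← mul_assoc, ← mul_pow]
        norm_num

end PowersetSums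

/-! ### Sums over integers and primes weighted by powers of logarithms -/

theorem succ_mul_sub_mul_pow_le {a b : ℝ} (hb : 0 ≤ b) (hab : b ≤ a) (j : ℕ) :
    (j + 1) * (a - b) * b ^ j ≤ a ^ (j + 1) - b ^ (j + 1) := by
  induction j with
  | zero => simp
  | succ j ih =>
    have h1 : b ^ (j + 1) ≤ a ^ (j + 1) := pow_le_pow_left₀ hb hab _
    have h2 : 0 ≤ a - b := by linarith
    push_cast
    calc ((j : ℝ) + 1 + 1) * (a - b) * b ^ (j + 1)
        = b * ((j + 1) * (a - b) * b ^ j) + (a - b) * b ^ (j + 1) := by ring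
      _ ≤ b * (a ^ (j + 1) - b ^ (j + 1)) + (a - b) * a ^ (j + 1) := by gcongr
      _ = _ := by ring

/-- One step of the comparison of `∑ (v - u) (t - v)₊ ^ j` with `∫ (t - v)₊ ^ j dv`. -/
theorem sub_mul_posPart_pow_le {t u v : ℝ} (huv : u ≤ v) {j : ℕ} (hj : j ≠ 0) :
    (v - u) * max (t - v) 0 ^ j ≤
      (max (t - u) 0 ^ (j + 1) - max (t - v) 0 ^ (j + 1)) / (j + 1) := by
  rcases le_total (t - v) 0 with h | h
  · rw [max_eq_right h, zero_pow hj, mul_zero, zero_pow (by simp), sub_zero]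
    have : 0 ≤ max (t - u) 0 := le_max_right _ _
    positivity
  · rw [max_eq_left h, max_eq_left (by linarith), le_div_iff₀ (by positivity)]
    have := succ_mul_sub_mul_pow_le h (by linarith : t - v ≤ t - u) j
    linarith

theorem sum_log_diff_mul_posPart_pow_le (t : ℝ) {j : ℕ} (hj : j ≠ 0) (n : ℕ) :
    ∑ i ∈ range n, (Real.log (i + 2) - Real.log (i + 1)) * max (t - Real.log (i + 2)) 0 ^ j ≤
      max t 0 ^ (j + 1) / (j + 1) := by
  suffices h : ∑ i ∈ range n,
      (Real.log (i + 2) - Real.log (i + 1)) * max (t - Real.log (i + 2)) 0 ^ j ≤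
      (max t 0 ^ (j + 1) - max (t - Real.log (n + 1)) 0 ^ (j + 1)) / (j + 1) by
    refine h.trans ?_
    gcongr
    have : 0 ≤ max (t - Real.log (n + 1)) 0 ^ (j + 1) := pow_nonneg (le_max_right _ _) _
    linarith
  induction n with
  | zero => simp
  | succ n ih =>
    rw [sum_range_succ]
    have h := sub_mul_posPart_pow_le (t := t)
      (Real.log_le_log (by positivity) (by linarith : (n : ℝ) + 1 ≤ n + 2)) hj
    push_cast
    rw [show (n : ℝ) + 1 + 1 = n + 2 by ring]
    calc _ ≤ _ := add_le_add ih h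
      _ = _ := by ring

/-- Abel summation: against a decreasing nonnegative sequence, a sequence with partial sums at
most `C` has sum at most `C` times the first term. -/
theorem sum_mul_antitone_le {a c : ℕ → ℝ} (ha : Antitone a) (ha0 : ∀ i, 0 ≤ a i) {C : ℝ}
    (hC : ∀ n, ∑ i ∈ range n, c i ≤ C) (n : ℕ) :
    ∑ i ∈ range n, c i * a i ≤ C * a 0 := by
  cases n with
  | zero => simpa using mul_nonneg (by simpa using hC 0) (ha0 0)
  | succ n =>
    suffices h : ∑ i ∈ range (n + 1), c i * a i ≤
        (∑ i ∈ range (n + 1), c i - C) * a n + C * a 0 by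
      have := hC (n + 1)
      have := ha0 n
      nlinarith
    induction n with
    | zero => simp only [zero_add, sum_range_one]; linarith
    | succ n ih =>
      rw [sum_range_succ]
      have h1 : (∑ i ∈ range (n + 1), c i - C) * a n ≤
          (∑ i ∈ range (n + 1), c i - C) * a (n + 1) :=
        mul_le_mul_of_nonpos_left (ha n.le_succ) (by linarith [hC (n + 1)])
      rw [sum_range_succ _ (n + 1)]
      linarith

/-- The upper bound in Mertens' first theorem. It follows from `n! ≤ n ^ n`, the multiplicity of
each prime in `n!` and Chebyshev's bound `θ(n) ≤ n log 4`. -/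
theorem sum_log_div_prime_le (n : ℕ) (hn : n ≠ 0) :
    ∑ p ∈ Icc 1 n with p.Prime, Real.log p / p ≤ Real.log n + Real.log 4 := by
  have hn0 : (0 : ℝ) < n := by positivity
  have h1 : ∑ p ∈ Icc 1 n with p.Prime, Real.log p * ((n / p : ℕ) : ℝ) ≤
      ∑ m ∈ Icc 1 n, Real.log m := by
    have h2 : ∀ m ∈ Icc 1 n, ∑ p ∈ Icc 1 n with p.Prime, (if p ∣ m then Real.log p else 0) ≤
        Real.log m := by
      intro m hm
      rw [mem_Icc] at hm
      rw [← ArithmeticFunction.vonMangoldt_sum, ← sum_filter]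
      calc _ = ∑ p ∈ {p ∈ Icc 1 n | p.Prime} with p ∣ m, ArithmeticFunction.vonMangoldt p := by
            refine sum_congr rfl fun p hp => ?_
            simp only [mem_filter] at hp
            rw [ArithmeticFunction.vonMangoldt_apply_prime hp.1.2]
        _ ≤ _ := by
            refine sum_le_sum_of_subset_of_nonneg (fun p hp => ?_)
              fun _ _ _ => ArithmeticFunction.vonMangoldt_nonneg
            simp only [mem_filter] at hp
            exact Nat.mem_divisors.2 ⟨hp.2, by omega⟩
    refine le_trans (le_of_eq ?_) (sum_le_sum h2)
    rw [sum_comm]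
    refine sum_congr rfl fun p _ => ?_
    rw [← sum_filter, sum_const, nsmul_eq_mul, mul_comm, ← Nat.Ioc_filter_dvd_card_eq_div]
    rfl
  have h3 : ∑ m ∈ Icc 1 n, Real.log m ≤ n * Real.log n := by
    calc _ ≤ ∑ m ∈ Icc 1 n, Real.log n := by
          refine sum_le_sum fun m hm => ?_
          rw [mem_Icc] at hm
          exact Real.log_le_log (by exact_mod_cast hm.1) (by exact_mod_cast hm.2)
      _ = _ := by simp
  have h4 : ∑ p ∈ Icc 1 n with p.Prime, Real.log p ≤ Real.log 4 * n := by
    have := Chebyshev.theta_le_log4_mul_x hn0.le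
    rw [Chebyshev.theta, Nat.floor_natCast] at this
    exact this
  have h5 : ∑ p ∈ Icc 1 n with p.Prime, Real.log p * ((n : ℝ) / p - 1) ≤
      ∑ p ∈ Icc 1 n with p.Prime, Real.log p * ((n / p : ℕ) : ℝ) := by
    refine sum_le_sum fun p hp => ?_
    rw [mem_filter, mem_Icc] at hp
    have hlog : 0 ≤ Real.log p := Real.log_natCast_nonneg p
    refine mul_le_mul_of_nonneg_left ?_ hlog
    have := Nat.lt_floor_add_one ((n : ℝ) / p)
    rw [Nat.floor_div_natCast, Nat.floor_natCast] at this
    linarith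
  have h6 : ∑ p ∈ Icc 1 n with p.Prime, Real.log p * ((n : ℝ) / p - 1) =
      n * ∑ p ∈ Icc 1 n with p.Prime, Real.log p / p - ∑ p ∈ Icc 1 n with p.Prime, Real.log p := by
    rw [mul_sum, ← sum_sub_distrib]
    exact sum_congr rfl fun p _ => by ring
  rw [← mul_le_mul_iff_right₀ hn0]
  linarith

/-- Mertens' theorem weighted by a power of `(t - log p)₊`. -/
theorem sum_log_div_mul_posPart_pow_le (P : Finset ℕ) (hP : ∀ p ∈ P, p.Prime) (t : ℝ)
    {j : ℕ} (hj : j ≠ 0) :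
    ∑ p ∈ P, Real.log p / p * max (t - Real.log p) 0 ^ j ≤
      max t 0 ^ (j + 1) / (j + 1) + Real.log 4 * max t 0 ^ j := by
  obtain ⟨n, hn⟩ : ∃ n, P ⊆ range n := ⟨P.sup id + 1, fun p hp => by
    rw [mem_range, Nat.lt_succ_iff]; exact le_sup (f := id) hp⟩
  set a : ℕ → ℝ := fun i => max (t - Real.log (i + 1)) 0 ^ j with ha
  have ha0 : ∀ i, 0 ≤ a i := fun i => pow_nonneg (le_max_right _ _) _
  have hanti : Antitone a := by
    intro i i' hii
    have : (i : ℝ) ≤ i' := by exact_mod_cast hii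
    have : Real.log (i + 1) ≤ Real.log (i' + 1) :=
      Real.log_le_log (by positivity) (by linarith)
    exact pow_le_pow_left₀ (le_max_right _ _) (max_le_max_right 0 (by linarith)) _
  -- compare `log p / p` with the increments `d` of the logarithm, indexing integers from `1`
  set b : ℕ → ℝ := fun i => if (i + 1).Prime then Real.log (i + 1) / (i + 1) else 0 with hb
  set d : ℕ → ℝ := fun i => Real.log (i + 1) - Real.log i with hd
  have hdsum : ∀ m : ℕ, ∑ i ∈ range m, d i = Real.log m := by
    intro m
    have := sum_range_sub (fun i : ℕ => Real.log i) m
    simpa [hd] using this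
  have hbsum : ∀ m : ℕ, ∑ i ∈ range m, b i = ∑ p ∈ Icc 1 m with p.Prime, Real.log p / p := by
    intro m
    rw [sum_filter, ← Ico_add_one_right_eq_Icc, sum_Ico_eq_sum_range]
    simp only [Nat.add_sub_cancel, hb]
    refine sum_congr rfl fun i _ => ?_
    rw [add_comm 1 i]; push_cast; rfl
  have hC : ∀ m, ∑ i ∈ range m, (b i - d i) ≤ Real.log 4 := by
    intro m
    rw [sum_sub_distrib, hdsum, hbsum]
    rcases eq_or_ne m 0 with rfl | hm
    · simp [Real.log_nonneg]
    · linarith [sum_log_div_prime_le m hm]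
  have h1 := sum_mul_antitone_le hanti ha0 hC n
  have h2 : ∑ i ∈ range n, d i * a i ≤ max t 0 ^ (j + 1) / (j + 1) := by
    cases n with
    | zero =>
      simp only [range_zero, sum_empty]
      have : 0 ≤ max t 0 := le_max_right _ _
      positivity
    | succ n =>
      rw [sum_range_succ']
      have h0 : d 0 * a 0 = 0 := by simp [hd]
      rw [h0, add_zero]
      refine le_trans (le_of_eq ?_) (sum_log_diff_mul_posPart_pow_le t hj n)
      refine sum_congr rfl fun i _ => ?_
      simp only [hd, ha]
      push_cast
      rw [show (i : ℝ) + 1 + 1 = i + 2 by ring]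
  have h3 : ∑ p ∈ P, Real.log p / p * max (t - Real.log p) 0 ^ j ≤ ∑ i ∈ range n, b i * a i := by
    have hinj : Set.InjOn (fun p : ℕ => p - 1) P := by
      intro p hp q hq hpq
      have := (hP p hp).one_lt
      have := (hP q hq).one_lt
      simp only at hpq
      omega
    calc _ = ∑ i ∈ P.image (fun p => p - 1), b i * a i := by
          rw [sum_image hinj]
          refine sum_congr rfl fun p hp => ?_
          have h1 := (hP p hp).one_lt
          have h2 : ((p - 1 : ℕ) : ℝ) + 1 = p := by
            rw [Nat.cast_sub h1.le]; simp
          simp only [hb, ha, h2, Nat.sub_add_cancel h1.le, if_pos (hP p hp)]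
      _ ≤ _ := by
          refine sum_le_sum_of_subset_of_nonneg ?_ fun i _ _ => mul_nonneg ?_ (ha0 i)
          · intro i hi
            rw [mem_image] at hi
            obtain ⟨p, hp, rfl⟩ := hi
            have := mem_range.1 (hn hp)
            have := (hP p hp).one_lt
            rw [mem_range]; omega
          · simp only [hb]
            split_ifs
            · exact div_nonneg (Real.log_nonneg (by linarith [i.cast_nonneg (α := ℝ)]))
                (by positivity)
            · exact le_rfl
  have h4 : ∑ i ∈ range n, b i * a i =
      ∑ i ∈ range n, (b i - d i) * a i + ∑ i ∈ range n, d i * a i := by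
    rw [← sum_add_distrib]
    exact sum_congr rfl fun i _ => by ring
  have h5 : a 0 = max t 0 ^ j := by simp [ha]
  rw [h5] at h1
  linarith

theorem exists_sum_log_div_sq_le :
    ∃ C : ℝ, 0 ≤ C ∧ ∀ P : Finset ℕ, ∑ p ∈ P, Real.log p / (p : ℝ) ^ 2 ≤ C := by
  have hs : Summable fun n : ℕ => 2 * (1 / (n : ℝ) ^ (3 / 2 : ℝ)) :=
    (Real.summable_one_div_nat_rpow.2 (by norm_num)).mul_left 2
  refine ⟨∑' n : ℕ, 2 * (1 / (n : ℝ) ^ (3 / 2 : ℝ)), tsum_nonneg fun n => by positivity,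
    fun P => ?_⟩
  refine le_trans (sum_le_sum fun p _ => ?_) (hs.sum_le_tsum P fun n _ => by positivity)
  rcases Nat.eq_zero_or_pos p with rfl | hp
  · simp
  have hp0 : (0 : ℝ) < p := by exact_mod_cast hp
  have h1 := Real.log_le_rpow_div hp0.le (by norm_num : (0 : ℝ) < 1 / 2)
  have h2 : (p : ℝ) ^ 2 = (p : ℝ) ^ (1 / 2 : ℝ) * (p : ℝ) ^ (3 / 2 : ℝ) := by
    rw [← Real.rpow_add hp0, ← Real.rpow_natCast]; norm_num
  rw [h2, div_le_iff₀ (by positivity)]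
  have h3 : (p : ℝ) ^ (3 / 2 : ℝ) ≠ 0 := by positivity
  calc Real.log p ≤ (p : ℝ) ^ (1 / 2 : ℝ) / (1 / 2) := h1
    _ = _ := by field_simp

/-- `ell t S` is the positive part of `t - log (∏ p ∈ S, p)`. -/
noncomputable def ell (t : ℝ) (S : Finset ℕ) : ℝ :=
  max (t - ∑ p ∈ S, Real.log p) 0

theorem ell_nonneg (t : ℝ) (S : Finset ℕ) : 0 ≤ ell t S := le_max_right _ _

theorem ell_empty (t : ℝ) : ell t ∅ = max t 0 := by simp [ell]

theorem ell_union {t : ℝ} {S T : Finset ℕ} (h : Disjoint S T) :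
    ell t (S ∪ T) = ell (t - ∑ p ∈ S, Real.log p) T := by
  rw [ell, ell, sum_union h, sub_sub]

theorem ell_anti_left {t t' : ℝ} (h : t ≤ t') (S : Finset ℕ) : ell t S ≤ ell t' S :=
  max_le_max_right 0 (by linarith)

theorem sum_log_nonneg (S : Finset ℕ) : 0 ≤ ∑ p ∈ S, Real.log (p : ℝ) :=
  sum_nonneg fun p _ => Real.log_natCast_nonneg p

theorem ell_le {t : ℝ} (S : Finset ℕ) : ell t S ≤ max t 0 :=
  max_le_max_right 0 (by linarith [sum_log_nonneg S])

theorem prod_pos_of_prime {S : Finset ℕ} (hS : ∀ p ∈ S, p.Prime) : 0 < ∏ p ∈ S, p :=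
  prod_pos fun p hp => (hS p hp).pos

theorem one_sub_inv_pos_of_prime {p : ℕ} (hp : p.Prime) : 0 < 1 - (p : ℝ)⁻¹ := by
  have : (1 : ℝ) < p := by exact_mod_cast hp.one_lt
  linarith [inv_lt_one_of_one_lt₀ this]

theorem log_prod_primes {S : Finset ℕ} (hS : ∀ p ∈ S, p.Prime) :
    Real.log ((∏ p ∈ S, p : ℕ) : ℝ) = ∑ p ∈ S, Real.log p := by
  push_cast
  exact Real.log_prod fun p hp => by exact_mod_cast (hS p hp).ne_zero

theorem injOn_prod_primes {P : Finset ℕ} (hP : ∀ p ∈ P, p.Prime) :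
    Set.InjOn (fun T : Finset ℕ => ∏ p ∈ T, p) {T | T ⊆ P} := by
  intro S hS T hT h
  have h1 := Nat.primeFactors_prod (s := S) fun p hp => hP p (hS hp)
  have h2 := Nat.primeFactors_prod (s := T) fun p hp => hP p (hT hp)
  simp only at h
  rw [← h1, ← h2, h]

theorem ell_eq {t : ℝ} {S : Finset ℕ} (hS : ∀ p ∈ S, p.Prime) :
    ell t S = max (t - Real.log ((∏ p ∈ S, p : ℕ) : ℝ)) 0 := by
  rw [log_prod_primes hS, ell]

/-- The harmonic sum over integers coprime to `W`, weighted by `(t - log m)₊ ^ 2`. -/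
theorem sum_coprime_inv_mul_posPart_sq_le (W : ℕ) (hW : 0 < W) (t : ℝ) (n : ℕ) :
    ∑ m ∈ range n with W.Coprime m, (m : ℝ)⁻¹ * max (t - Real.log m) 0 ^ 2 ≤
      (W.totient / W : ℝ) * (max t 0 ^ 3 / 3) + 2 * W.totient * max t 0 ^ 2 := by
  set f : ℕ → ℝ := fun m => (m : ℝ)⁻¹ * max (t - Real.log m) 0 ^ 2 with hf
  have hf0 : ∀ m, 0 ≤ f m := fun m => by positivity
  have hW1 : (1 : ℝ) ≤ W := by exact_mod_cast hW
  have ht0 : 0 ≤ max t 0 := le_max_right _ _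
  have hanti : ∀ m m' : ℕ, 0 < m → m ≤ m' → f m' ≤ f m := by
    intro m m' hm hmm
    have hm0 : (0 : ℝ) < m := by exact_mod_cast hm
    have h1 : (m : ℝ) ≤ m' := by exact_mod_cast hmm
    have h2 := Real.log_le_log hm0 h1
    simp only [hf]
    gcongr
  have hf1 : ∀ m, f m ≤ max t 0 ^ 2 := by
    intro m
    rcases Nat.eq_zero_or_pos m with rfl | hm
    · simp only [hf, Nat.cast_zero, inv_zero, zero_mul]; positivity
    · refine (hanti 1 m one_pos hm).trans ?_
      simp [hf]
  -- each block of `W` consecutive integers has `φ(W)` members coprime to `W`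
  have hblock : ∀ q : ℕ, ∀ c : ℝ, (∀ m ∈ Ico (q * W) (q * W + W), f m ≤ c) →
      ∑ m ∈ Ico (q * W) (q * W + W) with W.Coprime m, f m ≤ W.totient * c := by
    intro q c hc
    refine (sum_le_sum fun m hm => hc m (mem_filter.1 hm).1).trans ?_
    rw [sum_const, Nat.filter_coprime_Ico_eq_totient, nsmul_eq_mul]
  have hmain : ∀ q : ℕ, ∑ m ∈ range ((q + 1) * W) with W.Coprime m, f m ≤
      W.totient * max t 0 ^ 2 + (W.totient / W : ℝ) * ∑ i ∈ range q, f (i + 1) := by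
    intro q
    induction q with
    | zero =>
      have := hblock 0 (max t 0 ^ 2) fun m _ => hf1 m
      simpa using this
    | succ q ih =>
      have hsplit : ∑ m ∈ range ((q + 1 + 1) * W) with W.Coprime m, f m =
          ∑ m ∈ range ((q + 1) * W) with W.Coprime m, f m +
          ∑ m ∈ Ico ((q + 1) * W) ((q + 1) * W + W) with W.Coprime m, f m := by
        rw [sum_filter, sum_filter, sum_filter, sum_range_add_sum_Ico _ (by omega)]
        congr 2
        ring
      have h1 := hblock (q + 1) (f ((q + 1) * W)) fun m hm =>
        hanti _ _ (by positivity) (mem_Ico.1 hm).1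
      have h2 : f ((q + 1) * W) ≤ (W : ℝ)⁻¹ * f (q + 1) := by
        simp only [hf]
        push_cast
        have hq : (0 : ℝ) < q + 1 := by positivity
        rw [mul_inv, ← mul_assoc, mul_comm (W : ℝ)⁻¹]
        gcongr
        nlinarith
      rw [hsplit, sum_range_succ]
      calc _ ≤ _ := add_le_add ih (h1.trans (mul_le_mul_of_nonneg_left h2 (by positivity)))
        _ = _ := by rw [div_eq_mul_inv]; ring
  have htail : ∀ q : ℕ, ∑ i ∈ range q, f (i + 1) ≤ max t 0 ^ 2 + max t 0 ^ 3 / 3 := by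
    intro q
    cases q with
    | zero => simp only [range_zero, sum_empty]; positivity
    | succ q =>
      rw [sum_range_succ', add_comm]
      refine add_le_add (hf1 _) ?_
      have h := sum_log_diff_mul_posPart_pow_le t (two_ne_zero) q
      norm_num at h
      refine le_trans (sum_le_sum fun i _ => ?_) h
      simp only [hf]
      push_cast
      rw [show (i : ℝ) + 1 + 1 = i + 2 by ring]
      gcongr
      have h1 : (0 : ℝ) < i + 1 := by positivity
      have h2 := Real.one_sub_inv_le_log_of_pos (x := ((i : ℝ) + 2) / (i + 1)) (by positivity)
      rw [Real.log_div (by positivity) (by positivity)] at h2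
      refine le_trans (le_of_eq ?_) h2
      field_simp
      ring
  have hle : n ≤ (n + 1) * W := by nlinarith
  calc _ ≤ ∑ m ∈ range ((n + 1) * W) with W.Coprime m, f m :=
        sum_le_sum_of_subset_of_nonneg
          (filter_subset_filter _ (range_mono hle)) fun m _ _ => hf0 m
    _ ≤ _ := hmain n
    _ ≤ W.totient * max t 0 ^ 2 +
        (W.totient / W : ℝ) * (max t 0 ^ 2 + max t 0 ^ 3 / 3) := by
        gcongr
        exact htail n
    _ ≤ _ := by
        have h1 : (W.totient / W : ℝ) ≤ W.totient := div_le_self (by positivity) hW1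
        have h2 : (W.totient / W : ℝ) * max t 0 ^ 2 ≤ W.totient * max t 0 ^ 2 := by gcongr
        linarith

theorem sq_posPart_div_two_le_sum (t : ℝ) (n : ℕ) (hn : t ≤ Real.log (n + 1)) :
    max t 0 ^ 2 / 2 ≤ ∑ i ∈ range n, ((i : ℝ) + 1)⁻¹ * max (t - Real.log (i + 1)) 0 := by
  have h : ∀ m : ℕ, (max t 0 ^ 2 - max (t - Real.log (m + 1)) 0 ^ 2) / 2 ≤
      ∑ i ∈ range m, ((i : ℝ) + 1)⁻¹ * max (t - Real.log (i + 1)) 0 := by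
    intro m
    induction m with
    | zero => simp
    | succ m ih =>
      rw [sum_range_succ]
      push_cast
      rw [show (m : ℝ) + 1 + 1 = m + 2 by ring]
      have hm : (0 : ℝ) < m + 1 := by positivity
      have hd : Real.log (m + 2) - Real.log (m + 1) ≤ ((m : ℝ) + 1)⁻¹ := by
        have := Real.log_le_sub_one_of_pos (x := ((m : ℝ) + 2) / (m + 1)) (by positivity)
        rw [Real.log_div (by positivity) (by positivity)] at this
        refine this.trans (le_of_eq ?_)
        field_simp
        ring
      have hmono : Real.log (m + 1) ≤ Real.log (m + 2) := Real.log_le_log hm (by linarith)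
      set A := max (t - Real.log (m + 1)) 0 with hA
      set B := max (t - Real.log (m + 2)) 0 with hB
      have hB0 : 0 ≤ B := le_max_right _ _
      have hBA : B ≤ A := max_le_max_right 0 (by linarith)
      have hAB : A - B ≤ ((m : ℝ) + 1)⁻¹ := by
        refine le_trans ?_ hd
        rw [sub_le_iff_le_add, hA]
        refine max_le ?_ (by linarith)
        linarith [le_max_left (t - Real.log (m + 2)) 0]
      nlinarith
  have := h n
  rw [max_eq_right (by linarith : t - Real.log (n + 1) ≤ 0)] at this
  simpa using this

/-- A partial sum of `1 / m` over integers `m` composed of primes in `S` is bounded by the Euler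
product. -/
theorem sum_inv_factored_le {S : Finset ℕ} (hS : ∀ p ∈ S, p.Prime) (M : Finset ℕ)
    (hM : ∀ m ∈ M, m ∈ Nat.factoredNumbers S) :
    ∑ m ∈ M, (m : ℝ)⁻¹ ≤ ∏ p ∈ S, (1 - (p : ℝ)⁻¹)⁻¹ := by
  let f : ℕ →* ℝ := { toFun := fun n => (n : ℝ)⁻¹, map_one' := by simp, map_mul' := by
                        intro a b; push_cast; rw [mul_inv] }
  have h := EulerProduct.summable_and_hasSum_factoredNumbers_prod_filter_prime_geometric
    (f := f) (fun {p} hp => by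
      have h1 : (1 : ℝ) < p := by exact_mod_cast hp.one_lt
      change ‖(p : ℝ)⁻¹‖ < 1
      rw [norm_inv, Real.norm_natCast]
      exact inv_lt_one_of_one_lt₀ h1) S
  have h2 : ∏ p ∈ S, (1 - (p : ℝ)⁻¹)⁻¹ = ∏ p ∈ S with p.Prime, (1 - f p)⁻¹ := by
    rw [filter_true_of_mem hS]; rfl
  rw [h2]
  have h3 : ∑ m ∈ M, (m : ℝ)⁻¹ =
      ∑ m ∈ M.subtype (· ∈ Nat.factoredNumbers S), f (m : ℕ) := by
    rw [sum_subtype_of_mem _ hM]; rfl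
  rw [h3]
  exact sum_le_hasSum _ (fun m _ => inv_nonneg.2 (Nat.cast_nonneg _)) h.2

/-! ### Lower and upper bounds for sieve sums; the moments -/

/-- The lower bound for the sums occurring when the quadratic form of the primes is expressed in
the variables that diagonalise the one of the integers. Each `n ≤ exp t` is sorted by the set of
its prime factors outside `Q`; the sum of `1 / n` over a class is bounded by an Euler product. -/
theorem prod_mul_sq_posPart_le_sum_ell (P Q : Finset ℕ) (hP : ∀ p ∈ P, p.Prime)
    (hQ : ∀ p ∈ Q, p.Prime) (hPQ : Disjoint P Q) (t : ℝ)
    (hcover : ∀ p : ℕ, p.Prime → Real.log p ≤ t → p ∈ P ∪ Q) :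
    (∏ p ∈ Q, (1 - (p : ℝ)⁻¹)) * (max t 0 ^ 2 / 2) ≤
      ∑ T ∈ P.powerset, (∏ p ∈ T, ((p : ℝ) - 1)⁻¹) * ell t T := by
  set X := ⌊Real.exp t⌋₊ with hX
  have hXt : t ≤ Real.log (X + 1) := by
    rw [Real.le_log_iff_exp_le (by positivity)]
    exact (Nat.lt_floor_add_one _).le
  have h1 := sq_posPart_div_two_le_sum t X hXt
  have h2 : ∑ i ∈ range X, ((i : ℝ) + 1)⁻¹ * max (t - Real.log (i + 1)) 0 =
      ∑ n ∈ Icc 1 X, (n : ℝ)⁻¹ * max (t - Real.log n) 0 := by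
    rw [← Ico_add_one_right_eq_Icc, sum_Ico_eq_sum_range]
    refine sum_congr (by simp) fun i _ => ?_
    rw [add_comm 1 i]; push_cast; rfl
  have hmaps : ∀ n ∈ Icc 1 X, n.primeFactors \ Q ∈ P.powerset := by
    intro n hn
    rw [mem_Icc] at hn
    rw [mem_powerset]
    intro p hp
    rw [mem_sdiff, Nat.mem_primeFactors] at hp
    have hpn : p ≤ X := (Nat.le_of_dvd (by omega) hp.1.2.1).trans hn.2
    have hpt : Real.log p ≤ t := by
      rw [Real.log_le_iff_le_exp (by exact_mod_cast hp.1.1.pos)]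
      exact (Nat.le_floor_iff (Real.exp_pos t).le).1 hpn
    exact (mem_union.1 (hcover p hp.1.1 hpt)).resolve_right hp.2
  have hfib : ∀ T ∈ P.powerset, ∑ n ∈ Icc 1 X with n.primeFactors \ Q = T,
      (n : ℝ)⁻¹ * max (t - Real.log n) 0 ≤
      (∏ p ∈ Q, (1 - (p : ℝ)⁻¹)⁻¹) * ((∏ p ∈ T, ((p : ℝ) - 1)⁻¹) * ell t T) := by
    intro T hT
    rw [mem_powerset] at hT
    have hTp : ∀ p ∈ T, p.Prime := fun p hp => hP p (hT hp)
    set d := ∏ p ∈ T, p with hd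
    have hd0 : 0 < d := prod_pos_of_prime hTp
    have hd0' : (0 : ℝ) < d := by exact_mod_cast hd0
    set s := {n ∈ Icc 1 X | n.primeFactors \ Q = T} with hs
    have hmem : ∀ n ∈ s, 0 < n ∧ n.primeFactors \ Q = T ∧ d ∣ n := by
      intro n hn
      rw [hs, mem_filter, mem_Icc] at hn
      refine ⟨by omega, hn.2, ?_⟩
      refine (prod_dvd_prod_of_subset T n.primeFactors _ ?_).trans (Nat.prod_primeFactors_dvd n)
      rw [← hn.2]; exact sdiff_subset
    -- the cofactor `n / d` is composed of primes in `T ∪ Q`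
    have hinv : ∑ n ∈ s, (n : ℝ)⁻¹ ≤
        (d : ℝ)⁻¹ * ∏ p ∈ T ∪ Q, (1 - (p : ℝ)⁻¹)⁻¹ := by
      have hinj : Set.InjOn (fun n => n / d) s := by
        intro n hn n' hn' h
        simp only at h
        rw [← Nat.div_mul_cancel (hmem n hn).2.2, h, Nat.div_mul_cancel (hmem n' hn').2.2]
      have h3 := sum_inv_factored_le (S := T ∪ Q)
        (fun p hp => (mem_union.1 hp).elim (hTp p) (hQ p)) (s.image (fun n => n / d)) (by
          intro m hm
          obtain ⟨n, hn, rfl⟩ := mem_image.1 hm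
          obtain ⟨h1, h2, h3⟩ := hmem n hn
          refine Nat.mem_factoredNumbers_of_primeFactors_subset
            (Nat.div_pos (Nat.le_of_dvd h1 h3) hd0).ne' ?_
          refine (Nat.primeFactors_mono (Nat.div_dvd_of_dvd h3) h1.ne').trans ?_
          intro p hp
          rw [mem_union, ← h2, mem_sdiff]
          tauto)
      rw [sum_image hinj] at h3
      refine le_trans (le_of_eq ?_) (mul_le_mul_of_nonneg_left h3 (inv_nonneg.2 hd0'.le))
      rw [mul_sum]
      refine sum_congr rfl fun n hn => ?_
      rw [Nat.cast_div (hmem n hn).2.2 hd0'.ne', inv_div]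
      field_simp
    calc _ ≤ ∑ n ∈ s, (n : ℝ)⁻¹ * ell t T := by
          refine sum_le_sum fun n hn => ?_
          obtain ⟨h1, h2, h3⟩ := hmem n hn
          refine mul_le_mul_of_nonneg_left ?_ (by positivity)
          rw [ell_eq hTp]
          have : Real.log d ≤ Real.log n :=
            Real.log_le_log hd0' (by exact_mod_cast Nat.le_of_dvd h1 h3)
          exact max_le_max_right 0 (by linarith)
      _ = (∑ n ∈ s, (n : ℝ)⁻¹) * ell t T := by rw [sum_mul]
      _ ≤ ((d : ℝ)⁻¹ * ∏ p ∈ T ∪ Q, (1 - (p : ℝ)⁻¹)⁻¹) * ell t T :=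
          mul_le_mul_of_nonneg_right hinv (ell_nonneg _ _)
      _ = _ := by
          rw [prod_union (hPQ.mono_left hT), hd]
          push_cast
          rw [← prod_inv_distrib, ← mul_assoc, ← prod_mul_distrib]
          have hTprod : ∏ p ∈ T, ((p : ℝ)⁻¹ * (1 - (p : ℝ)⁻¹)⁻¹) = ∏ p ∈ T, ((p : ℝ) - 1)⁻¹ := by
            refine prod_congr rfl fun p hp => ?_
            rw [← mul_inv, mul_sub, mul_inv_cancel₀
              (by exact_mod_cast (hTp p hp).ne_zero), mul_one]
          rw [hTprod]
          ring
  have h3 : ∑ n ∈ Icc 1 X, (n : ℝ)⁻¹ * max (t - Real.log n) 0 ≤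
      (∏ p ∈ Q, (1 - (p : ℝ)⁻¹)⁻¹) *
        ∑ T ∈ P.powerset, (∏ p ∈ T, ((p : ℝ) - 1)⁻¹) * ell t T := by
    rw [← sum_fiberwise_of_maps_to hmaps, mul_sum]
    exact sum_le_sum hfib
  have hQpos : 0 < ∏ p ∈ Q, (1 - (p : ℝ)⁻¹) := prod_pos fun p hp => one_sub_inv_pos_of_prime (hQ p hp)
  rw [prod_inv_distrib] at h3
  rw [← le_inv_mul_iff₀ hQpos]
  linarith

/-- Integers that are products of distinct primes in `P` are coprime to `W`, so sums over subsets
of `P` are dominated by sums over integers. -/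
theorem sum_powerset_prod_inv_mul_ell_sq_le (P : Finset ℕ) (hP : ∀ p ∈ P, p.Prime) (W : ℕ)
    (hW : 0 < W) (hPW : ∀ p ∈ P, W.Coprime p) (t : ℝ) :
    ∑ T ∈ P.powerset, (∏ p ∈ T, (p : ℝ)⁻¹) * ell t T ^ 2 ≤
      (W.totient / W : ℝ) * (max t 0 ^ 3 / 3) + 2 * W.totient * max t 0 ^ 2 := by
  have hinj : Set.InjOn (fun T : Finset ℕ => ∏ p ∈ T, p) P.powerset :=
    (injOn_prod_primes hP).mono fun T hT => mem_powerset.1 hT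
  obtain ⟨n, hn⟩ : ∃ n, P.powerset.image (fun T : Finset ℕ => ∏ p ∈ T, p) ⊆ range n :=
    ⟨(P.powerset.image (fun T : Finset ℕ => ∏ p ∈ T, p)).sup id + 1, fun p hp => by
      rw [mem_range, Nat.lt_succ_iff]; exact le_sup (f := id) hp⟩
  refine le_trans ?_ (sum_coprime_inv_mul_posPart_sq_le W hW t n)
  calc _ = ∑ m ∈ P.powerset.image (fun T : Finset ℕ => ∏ p ∈ T, p),
        (m : ℝ)⁻¹ * max (t - Real.log m) 0 ^ 2 := by
        rw [sum_image hinj]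
        refine sum_congr rfl fun T hT => ?_
        rw [mem_powerset] at hT
        rw [ell_eq fun p hp => hP p (hT hp)]
        push_cast
        rw [prod_inv_distrib]
    _ ≤ _ := by
        refine sum_le_sum_of_subset_of_nonneg (fun m hm => ?_) fun m _ _ => by positivity
        rw [mem_filter]
        refine ⟨hn hm, ?_⟩
        obtain ⟨T, hT, rfl⟩ := mem_image.1 hm
        rw [mem_powerset] at hT
        exact Nat.Coprime.prod_right fun p hp => hPW p (hT hp)

theorem sum_powerset_prod_inv_sub_mul_ell_sq_le (P : Finset ℕ) (hP : ∀ p ∈ P, p.Prime) (W : ℕ)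
    (hW : 0 < W) (hPW : ∀ p ∈ P, W.Coprime p) (k : ℝ) (hk : 0 ≤ k)
    (hPk : ∀ p ∈ P, k < p) (t : ℝ) :
    ∑ T ∈ P.powerset, (∏ p ∈ T, ((p : ℝ) - k)⁻¹) * ell t T ^ 2 ≤
      (∏ p ∈ P, (1 + k / (p * (p - k)))) *
        ((W.totient / W : ℝ) * (max t 0 ^ 3 / 3) + 2 * W.totient * max t 0 ^ 2) := by
  have hp0 : ∀ p ∈ P, (0 : ℝ) < p := fun p hp => by exact_mod_cast (hP p hp).pos
  have hpk : ∀ p ∈ P, 0 < (p : ℝ) - k := fun p hp => by linarith [hPk p hp]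
  have h1 : ∀ T ∈ P.powerset, ∏ p ∈ T, ((p : ℝ) - k)⁻¹ =
      ∏ p ∈ T, (k / (p * (p - k)) + (p : ℝ)⁻¹) := by
    intro T hT
    rw [mem_powerset] at hT
    refine prod_congr rfl fun p hp => ?_
    have := (hp0 p (hT hp)).ne'
    have := (hpk p (hT hp)).ne'
    field_simp
    ring
  rw [sum_congr rfl fun T hT => by rw [h1 T hT], sum_powerset_prod_add, prod_one_add, sum_mul]
  refine sum_le_sum fun S hS => ?_
  rw [mem_powerset] at hS
  refine mul_le_mul_of_nonneg_left ?_ (prod_nonneg fun p hp => ?_)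
  · refine le_trans ?_ (sum_powerset_prod_inv_mul_ell_sq_le P hP W hW hPW t)
    calc _ ≤ ∑ T ∈ (P \ S).powerset, (∏ p ∈ T, (p : ℝ)⁻¹) * ell t T ^ 2 := by
          refine sum_le_sum fun T hT => ?_
          rw [ell_union (disjoint_of_mem_powerset_sdiff hT)]
          have h2 := ell_anti_left
            (by linarith [sum_log_nonneg S] : t - ∑ p ∈ S, Real.log (p : ℝ) ≤ t) T
          have h3 := ell_nonneg (t - ∑ p ∈ S, Real.log (p : ℝ)) T
          gcongr
      _ ≤ _ := by
          refine sum_le_sum_of_subset_of_nonneg (powerset_mono.2 sdiff_subset)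
            fun T _ _ => mul_nonneg (prod_nonneg fun p _ => by positivity) (sq_nonneg _)
  · have := hp0 p (hS hp)
    have := hpk p (hS hp)
    positivity

/-- The moments `∑ (∏ p ∈ S, (k - 1) / (p - k)) * (t - log (∏ p ∈ S, p))₊ ^ j` over subsets `S` of
`P`, in terms of which both quadratic forms are estimated. -/
noncomputable def sieveMoment (P : Finset ℕ) (k t : ℝ) (j : ℕ) : ℝ :=
  ∑ S ∈ P.powerset, (∏ p ∈ S, (k - 1) / (p - k)) * ell t S ^ j

theorem prod_div_nonneg {P S : Finset ℕ} {k : ℝ} (hk : 1 ≤ k) (hPk : ∀ p ∈ P, k < p)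
    (hS : S ⊆ P) : 0 ≤ ∏ p ∈ S, (k - 1) / ((p : ℝ) - k) :=
  prod_nonneg fun p hp => div_nonneg (by linarith) (by linarith [hPk p (hS hp)])

theorem sieveMoment_nonneg {P : Finset ℕ} {k : ℝ} (hk : 1 ≤ k) (hPk : ∀ p ∈ P, k < p) (t : ℝ)
    (j : ℕ) : 0 ≤ sieveMoment P k t j :=
  sum_nonneg fun S hS => mul_nonneg (prod_div_nonneg hk hPk (mem_powerset.1 hS))
    (pow_nonneg (ell_nonneg t S) j)

theorem pow_le_sieveMoment {P : Finset ℕ} {k : ℝ} (hk : 1 ≤ k) (hPk : ∀ p ∈ P, k < p) {t : ℝ}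
    (ht : 0 ≤ t) (j : ℕ) : t ^ j ≤ sieveMoment P k t j := by
  have := single_le_sum
    (f := fun S : Finset ℕ => (∏ p ∈ S, (k - 1) / ((p : ℝ) - k)) * ell t S ^ j)
    (fun S hS => mul_nonneg (prod_div_nonneg hk hPk (mem_powerset.1 hS))
      (pow_nonneg (ell_nonneg t S) j)) (empty_mem_powerset P)
  rw [sieveMoment]
  simpa only [prod_empty, ell_empty, max_eq_left ht, one_mul] using this

/-- The diagonal form of the integers, of sifting density `k`, in terms of moments of density
`k - 1`: the factor `k / (p - k)` is split as `(k - 1) / (p - k) + 1 / (p - k)`, and the second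
part is summed first. -/
theorem sum_prod_mul_ell_sq_le_sieveMoment (P : Finset ℕ) (hP : ∀ p ∈ P, p.Prime) (W : ℕ)
    (hW : 0 < W) (hPW : ∀ p ∈ P, W.Coprime p) (k : ℝ) (hk : 1 ≤ k)
    (hPk : ∀ p ∈ P, k < p) (t : ℝ) :
    ∑ T ∈ P.powerset, (∏ p ∈ T, k / ((p : ℝ) - k)) * ell t T ^ 2 ≤
      (∏ p ∈ P, (1 + k / (p * (p - k)))) *
        ((W.totient / W : ℝ) * (sieveMoment P k t 3 / 3) +
          2 * W.totient * sieveMoment P k t 2) := by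
  have hpk : ∀ p ∈ P, 0 < (p : ℝ) - k := fun p hp => by linarith [hPk p hp]
  have h1 : ∀ T : Finset ℕ, ∏ p ∈ T, k / ((p : ℝ) - k) =
      ∏ p ∈ T, ((k - 1) / (p - k) + ((p : ℝ) - k)⁻¹) :=
    fun T => prod_congr rfl fun p _ => by rw [div_eq_mul_inv, div_eq_mul_inv]; ring
  simp only [h1]
  rw [sum_powerset_prod_add]
  set c := ∏ p ∈ P, (1 + k / ((p : ℝ) * (p - k)))
  calc _ ≤ ∑ S ∈ P.powerset, (∏ p ∈ S, (k - 1) / ((p : ℝ) - k)) *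
        (c * ((W.totient / W : ℝ) * (ell t S ^ 3 / 3) + 2 * W.totient * ell t S ^ 2)) := by
        refine sum_le_sum fun S hS => ?_
        rw [mem_powerset] at hS
        refine mul_le_mul_of_nonneg_left ?_ (prod_div_nonneg hk hPk hS)
        refine le_trans ?_ (sum_powerset_prod_inv_sub_mul_ell_sq_le P hP W hW hPW k
          (by linarith) hPk (t - ∑ p ∈ S, Real.log (p : ℝ)))
        calc _ = ∑ T ∈ (P \ S).powerset, (∏ p ∈ T, ((p : ℝ) - k)⁻¹) *
              ell (t - ∑ p ∈ S, Real.log (p : ℝ)) T ^ 2 := by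
              refine sum_congr rfl fun T hT => ?_
              rw [ell_union (disjoint_of_mem_powerset_sdiff hT)]
          _ ≤ _ := by
              refine sum_le_sum_of_subset_of_nonneg (powerset_mono.2 sdiff_subset)
                fun T hT _ => mul_nonneg (prod_nonneg fun p hp => ?_) (sq_nonneg _)
              exact (inv_pos.2 (hpk p (mem_powerset.1 hT hp))).le
    _ = _ := by
        rw [sieveMoment, sieveMoment, sum_div, mul_sum, mul_sum, ← sum_add_distrib, mul_sum]
        exact sum_congr rfl fun S _ => by ring

/-- The recursion for the moments: writing `t - ell t S` as `∑ p ∈ S, log p` and summing over `p`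
with Mertens' theorem bounds `t * M j - M (j + 1)` by `(k - 1) * (M (j + 1) / (j + 1) + O(M j))`.
It replaces an asymptotic formula for sums of multiplicative functions. -/
theorem exists_sieveMoment_succ_ge (k : ℝ) (hk : 1 ≤ k) :
    ∃ C : ℝ, ∀ (P : Finset ℕ), (∀ p ∈ P, p.Prime) → (∀ p ∈ P, 2 * k ≤ p) → ∀ (t : ℝ) (j : ℕ),
      j ≠ 0 →
      (t - C) * sieveMoment P k t j ≤
        (1 + (k - 1) / (j + 1)) * sieveMoment P k t (j + 1) := by
  obtain ⟨C₀, hC₀, hC⟩ := exists_sum_log_div_sq_le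
  refine ⟨(k - 1) * (Real.log 4 + 2 * k * C₀), fun P hP hPk t j hj => ?_⟩
  have hPk' : ∀ p ∈ P, k < p := fun p hp => by linarith [hPk p hp]
  have hpk : ∀ p ∈ P, 0 < (p : ℝ) - k := fun p hp => by linarith [hPk' p hp]
  set G : Finset ℕ → ℝ := fun S => ∏ p ∈ S, (k - 1) / ((p : ℝ) - k) with hG
  have hG0 : ∀ S ⊆ P, 0 ≤ G S := fun S hS => prod_div_nonneg hk hPk' hS
  -- the sum over one prime
  have hinner : ∀ t' : ℝ, ∑ p ∈ P, Real.log p * ((k - 1) / (p - k)) * max (t' - Real.log p) 0 ^ j ≤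
      (k - 1) * (max t' 0 ^ (j + 1) / (j + 1) + (Real.log 4 + 2 * k * C₀) * max t' 0 ^ j) := by
    intro t'
    have h1 := sum_log_div_mul_posPart_pow_le P hP t' hj
    have h2 : ∑ p ∈ P, 2 * k * (Real.log p / p ^ 2) * max (t' - Real.log p) 0 ^ j ≤
        2 * k * C₀ * max t' 0 ^ j := by
      calc _ ≤ ∑ p ∈ P, 2 * k * (Real.log p / p ^ 2) * max t' 0 ^ j := by
            refine sum_le_sum fun p _ => ?_
            have hl := Real.log_natCast_nonneg p
            have : max (t' - Real.log p) 0 ≤ max t' 0 := max_le_max_right 0 (by linarith)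
            gcongr
        _ = 2 * k * (∑ p ∈ P, Real.log p / (p : ℝ) ^ 2) * max t' 0 ^ j := by
            rw [mul_sum, sum_mul]
        _ ≤ _ := by gcongr; exact hC P
    calc _ ≤ ∑ p ∈ P, (k - 1) * (Real.log p / p * max (t' - Real.log p) 0 ^ j +
          2 * k * (Real.log p / p ^ 2) * max (t' - Real.log p) 0 ^ j) := by
          refine sum_le_sum fun p hp => ?_
          have hp0 : (0 : ℝ) < p := by exact_mod_cast (hP p hp).pos
          have hl := Real.log_natCast_nonneg p
          have hb : 0 ≤ max (t' - Real.log p) 0 ^ j := pow_nonneg (le_max_right _ _) _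
          have h3 : 1 / ((p : ℝ) - k) ≤ 1 / p + 2 * k / p ^ 2 := by
            rw [div_add_div _ _ hp0.ne' (by positivity), div_le_div_iff₀ (hpk p hp) (by positivity)]
            have := hPk p hp
            have : 0 ≤ p * (k * ((p : ℝ) - 2 * k)) := by
              have : 0 ≤ (p : ℝ) - 2 * k := by linarith
              positivity
            nlinarith
          calc _ = (k - 1) * (Real.log p * max (t' - Real.log p) 0 ^ j) * (1 / (p - k)) := by ring
            _ ≤ (k - 1) * (Real.log p * max (t' - Real.log p) 0 ^ j) *
                (1 / p + 2 * k / p ^ 2) := by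
                refine mul_le_mul_of_nonneg_left h3 ?_
                exact mul_nonneg (by linarith) (mul_nonneg hl hb)
            _ = _ := by ring
      _ ≤ _ := by
          rw [← mul_sum, sum_add_distrib]
          refine mul_le_mul_of_nonneg_left ?_ (by linarith)
          linarith
  have hpt : ∀ S : Finset ℕ, t * ell t S ^ j - ell t S ^ (j + 1) =
      (∑ p ∈ S, Real.log (p : ℝ)) * ell t S ^ j := by
    intro S
    rcases le_total (t - ∑ p ∈ S, Real.log (p : ℝ)) 0 with h | h
    · have : ell t S = 0 := max_eq_right h
      simp [this, hj]
    · have : ell t S = t - ∑ p ∈ S, Real.log (p : ℝ) := max_eq_left h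
      rw [pow_succ]
      nth_rewrite 3 [this]
      ring
  -- single out a prime `p` of `S` and exchange the order of summation
  have h1 : t * sieveMoment P k t j - sieveMoment P k t (j + 1) =
      ∑ p ∈ P, ∑ S ∈ P.powerset with {p} ⊆ S, G S * Real.log p * ell t S ^ j := by
    rw [sieveMoment, sieveMoment, mul_sum, ← sum_sub_distrib]
    have h2 : ∀ S ∈ P.powerset, t * (G S * ell t S ^ j) - G S * ell t S ^ (j + 1) =
        ∑ p ∈ S, G S * Real.log p * ell t S ^ j := by
      intro S _
      rw [← sum_mul, ← mul_sum, mul_assoc, ← hpt]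
      ring
    rw [sum_congr rfl h2]
    refine sum_comm' fun S p => ?_
    simp only [mem_powerset, mem_filter, singleton_subset_iff]
    exact ⟨fun h => ⟨⟨h.1, h.2⟩, h.1 h.2⟩, fun h => h.1⟩
  have h2 : ∀ p ∈ P, ∑ S ∈ P.powerset with {p} ⊆ S, G S * Real.log p * ell t S ^ j ≤
      ∑ S ∈ P.powerset, G S * (Real.log p * ((k - 1) / (p - k)) *
        max ((t - ∑ q ∈ S, Real.log (q : ℝ)) - Real.log p) 0 ^ j) := by
    intro p hp
    rw [sum_powerset_superset P {p} (singleton_subset_iff.2 hp)]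
    refine le_trans (le_of_eq ?_) (sum_le_sum_of_subset_of_nonneg
      (powerset_mono.2 (sdiff_subset (s := P) (t := {p}))) ?_)
    · refine sum_congr rfl fun S hS => ?_
      have hd := disjoint_of_mem_powerset_sdiff hS
      simp only [hG, ell]
      rw [prod_union hd, sum_union hd, prod_singleton, sum_singleton, sub_sub,
        add_comm (Real.log (p : ℝ))]
      ring
    · intro S hS _
      refine mul_nonneg (hG0 S (mem_powerset.1 hS)) (mul_nonneg (mul_nonneg
        (Real.log_natCast_nonneg p) (div_nonneg (by linarith) (hpk p hp).le))
        (pow_nonneg (le_max_right _ _) _))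
  have h3 : t * sieveMoment P k t j - sieveMoment P k t (j + 1) ≤
      (k - 1) * (sieveMoment P k t (j + 1) / (j + 1) +
        (Real.log 4 + 2 * k * C₀) * sieveMoment P k t j) := by
    rw [h1]
    refine (sum_le_sum h2).trans ?_
    rw [sum_comm]
    calc _ ≤ ∑ S ∈ P.powerset, G S * ((k - 1) * (ell t S ^ (j + 1) / (j + 1) +
          (Real.log 4 + 2 * k * C₀) * ell t S ^ j)) := by
          refine sum_le_sum fun S hS => ?_
          rw [← mul_sum]
          exact mul_le_mul_of_nonneg_left (hinner _) (hG0 S (mem_powerset.1 hS))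
      _ = _ := by
          rw [sieveMoment, sieveMoment, sum_div, mul_sum, ← sum_add_distrib, mul_sum]
          exact sum_congr rfl fun S _ => by simp only [hG]; ring
  have h4 : (1 + (k - 1) / (j + 1)) * sieveMoment P k t (j + 1) =
      sieveMoment P k t (j + 1) + (k - 1) * (sieveMoment P k t (j + 1) / (j + 1)) := by ring
  rw [h4]
  linarith

/-! ### The two quadratic forms -/

/-- The sieve weights with `y = ell t`, for the change of variables belonging to the density
`g(p) = k / p` with which a prime `p` divides one of `k` distinct shifts of an integer. -/
noncomputable def gpyWeight (P : Finset ℕ) (k t : ℝ) : Finset ℕ → ℝ :=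
  selbergWeight P (fun p : ℕ => -((p : ℝ) / k)) (fun p : ℕ => k / ((p : ℝ) - k)) (ell t)

/-- The form of density `k / p` is diagonal in the variables `ell t`. -/
theorem quadForm_integers (P : Finset ℕ) (k : ℝ) (hk : 0 < k) (hPk : ∀ p ∈ P, k < p) (t : ℝ) :
    ∑ S ∈ P.powerset, ∑ T ∈ P.powerset, gpyWeight P k t S * gpyWeight P k t T *
        ∏ p ∈ S ∪ T, k / (p : ℝ) =
      ∑ V ∈ P.powerset, (∏ p ∈ V, k / ((p : ℝ) - k)) * ell t V ^ 2 := by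
  have hp0 : ∀ p ∈ P, (p : ℝ) ≠ 0 := fun p hp => by linarith [hPk p hp]
  have hpk : ∀ p ∈ P, (p : ℝ) - k ≠ 0 := fun p hp => by linarith [hPk p hp]
  rw [quadForm_eq_sum_sq P (fun p : ℕ => k / (p : ℝ))
    (fun p hp => div_ne_zero hk.ne' (hp0 p hp))]
  refine sum_congr rfl fun V hV => ?_
  rw [mem_powerset] at hV
  rw [gpyWeight, sum_selbergWeight_mul_prod]
  -- here `1 + c * g = 0`, so that only the empty set contributes
  have h1 : ∑ T ∈ (P \ V).powerset, (∏ p ∈ T, k / ((p : ℝ) - k) * (1 + -((p : ℝ) / k) * (k / p))) *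
      ell t (V ∪ T) = ell t V := by
    rw [sum_eq_single ∅]
    · simp
    · intro T hT hne
      obtain ⟨p, hp⟩ := nonempty_iff_ne_empty.2 hne
      rw [prod_eq_zero hp, zero_mul]
      have := hp0 p (mem_sdiff.1 (mem_powerset.1 hT hp)).1
      have := hk.ne'
      field_simp
      ring
    · simp
  rw [h1, mul_pow, ← mul_assoc, ← prod_pow, ← prod_mul_distrib]
  congr 1
  refine prod_congr rfl fun p hp => ?_
  have := hp0 p (hV hp)
  have := hpk p (hV hp)
  have := hk.ne'
  field_simp

/-- The form of density `(k - 1) / (p - 1)`, which belongs to the primes, expressed in the variables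
`ell t` that diagonalise the form of the integers. -/
theorem quadForm_primes (P : Finset ℕ) (k : ℝ) (hk : 1 < k) (hPk : ∀ p ∈ P, k < p) (t : ℝ) :
    ∑ S ∈ P.powerset, ∑ T ∈ P.powerset, gpyWeight P k t S * gpyWeight P k t T *
        ∏ p ∈ S ∪ T, (k - 1) / ((p : ℝ) - 1) =
      ∑ V ∈ P.powerset, (∏ p ∈ V, (k - 1) / ((p : ℝ) - k)) *
        ((∏ p ∈ V, (1 - (p : ℝ)⁻¹)⁻¹) *
          ∑ T ∈ (P \ V).powerset, (∏ p ∈ T, ((p : ℝ) - 1)⁻¹) * ell t (V ∪ T)) ^ 2 := by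
  have hp0 : ∀ p ∈ P, (p : ℝ) ≠ 0 := fun p hp => by linarith [hPk p hp]
  have hp1 : ∀ p ∈ P, (p : ℝ) - 1 ≠ 0 := fun p hp => by linarith [hPk p hp]
  have hpk : ∀ p ∈ P, (p : ℝ) - k ≠ 0 := fun p hp => by linarith [hPk p hp]
  have hk0 : k ≠ 0 := by linarith
  have hk1 : k - 1 ≠ 0 := by linarith
  rw [quadForm_eq_sum_sq P (fun p : ℕ => (k - 1) / ((p : ℝ) - 1))
    (fun p hp => div_ne_zero hk1 (hp1 p hp))]
  refine sum_congr rfl fun V hV => ?_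
  rw [mem_powerset] at hV
  rw [gpyWeight, sum_selbergWeight_mul_prod]
  have h1 : ∑ T ∈ (P \ V).powerset, (∏ p ∈ T, k / ((p : ℝ) - k) *
      (1 + -((p : ℝ) / k) * ((k - 1) / (p - 1)))) * ell t (V ∪ T) =
      ∑ T ∈ (P \ V).powerset, (∏ p ∈ T, ((p : ℝ) - 1)⁻¹) * ell t (V ∪ T) := by
    refine sum_congr rfl fun T hT => ?_
    congr 1
    refine prod_congr rfl fun p hp => ?_
    have hpP := (mem_sdiff.1 (mem_powerset.1 hT hp)).1
    have := hp1 p hpP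
    have := hpk p hpP
    field_simp
    ring
  rw [h1, mul_pow, mul_pow, ← mul_assoc, ← mul_assoc, ← prod_pow, ← prod_pow, ← prod_mul_distrib,
    ← prod_mul_distrib]
  congr 1
  refine prod_congr rfl fun p hp => ?_
  have h0 := hp0 p (hV hp)
  have h2 := hp1 p (hV hp)
  have h3 := hpk p (hV hp)
  have h4 : (1 - (p : ℝ)⁻¹)⁻¹ = p / (p - 1) := by
    rw [← inv_div, sub_div, div_self h0, one_div]
  rw [h4, inv_div]
  field_simp
  ring

/-- The factor `∏ p ∈ V, (1 - 1 / p)` lost in the lower bound for the inner sum cancels exactly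
against the factor produced by the diagonalisation. -/
theorem sieveMoment_four_le_quadForm_primes (P Q : Finset ℕ) (hP : ∀ p ∈ P, p.Prime)
    (hQ : ∀ p ∈ Q, p.Prime) (hPQ : Disjoint P Q) (k : ℝ) (hk : 1 < k) (hPk : ∀ p ∈ P, k < p)
    (t : ℝ) (hcover : ∀ p : ℕ, p.Prime → Real.log p ≤ t → p ∈ P ∪ Q) :
    (∏ p ∈ Q, (1 - (p : ℝ)⁻¹)) ^ 2 / 4 * sieveMoment P k t 4 ≤
      ∑ S ∈ P.powerset, ∑ T ∈ P.powerset, gpyWeight P k t S * gpyWeight P k t T *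
        ∏ p ∈ S ∪ T, (k - 1) / ((p : ℝ) - 1) := by
  rw [quadForm_primes P k hk hPk, sieveMoment, mul_sum]
  refine sum_le_sum fun V hV => ?_
  rw [mem_powerset] at hV
  have hVQ : Disjoint Q V := (hPQ.mono_left hV).symm
  have h1 := prod_mul_sq_posPart_le_sum_ell (P \ V) (Q ∪ V)
    (fun p hp => hP p (mem_sdiff.1 hp).1)
    (fun p hp => (mem_union.1 hp).elim (hQ p) fun h => hP p (hV h))
    (by
      rw [disjoint_union_right]
      exact ⟨hPQ.mono_left sdiff_subset, sdiff_disjoint⟩)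
    (t - ∑ p ∈ V, Real.log (p : ℝ)) (by
      intro p hp hpt
      have h2 := hcover p hp (by linarith [sum_log_nonneg V])
      simp only [mem_union, mem_sdiff] at h2 ⊢
      tauto)
  rw [prod_union hVQ] at h1
  have h2 : ∑ T ∈ (P \ V).powerset, (∏ p ∈ T, ((p : ℝ) - 1)⁻¹) * ell t (V ∪ T) =
      ∑ T ∈ (P \ V).powerset, (∏ p ∈ T, ((p : ℝ) - 1)⁻¹) *
        ell (t - ∑ p ∈ V, Real.log (p : ℝ)) T :=
    sum_congr rfl fun T hT => by rw [ell_union (disjoint_of_mem_powerset_sdiff hT)]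
  have hVpos : 0 < ∏ p ∈ V, (1 - (p : ℝ)⁻¹) := prod_pos fun p hp => one_sub_inv_pos_of_prime (hP p (hV hp))
  have hQpos : 0 < ∏ p ∈ Q, (1 - (p : ℝ)⁻¹) := prod_pos fun p hp => one_sub_inv_pos_of_prime (hQ p hp)
  have h3 : (∏ p ∈ Q, (1 - (p : ℝ)⁻¹)) * (ell t V ^ 2 / 2) ≤ (∏ p ∈ V, (1 - (p : ℝ)⁻¹)⁻¹) *
      ∑ T ∈ (P \ V).powerset, (∏ p ∈ T, ((p : ℝ) - 1)⁻¹) * ell t (V ∪ T) := by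
    rw [h2, prod_inv_distrib, le_inv_mul_iff₀ hVpos]
    refine le_trans (le_of_eq ?_) h1
    rw [ell]; ring
  have h4 : 0 ≤ (∏ p ∈ Q, (1 - (p : ℝ)⁻¹)) * (ell t V ^ 2 / 2) := by positivity
  have h5 := pow_le_pow_left₀ h4 h3 2
  calc _ = (∏ p ∈ V, (k - 1) / ((p : ℝ) - k)) *
        ((∏ p ∈ Q, (1 - (p : ℝ)⁻¹)) * (ell t V ^ 2 / 2)) ^ 2 := by ring
    _ ≤ _ := mul_le_mul_of_nonneg_left h5 (prod_div_nonneg hk.le hPk hV)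

/-! ### Reduction to residue classes -/

theorem exists_crt {M p : ℕ} (hp : p.Prime) (hM : ¬p ∣ M) (a b : ℤ) :
    ∃ c : ℤ, ∀ n : ℤ, n ≡ c [ZMOD (M * p : ℕ)] ↔ n ≡ a [ZMOD M] ∧ n ≡ b [ZMOD p] := by
  have hcop : IsCoprime (M : ℤ) p :=
    Nat.isCoprime_iff_coprime.2 ((Nat.Prime.coprime_iff_not_dvd hp).2 hM).symm
  obtain ⟨u, v, huv⟩ := hcop
  have hc1 : b * (u * M) + a * (v * p) ≡ a [ZMOD M] := by
    refine (Int.modEq_iff_dvd).2 ⟨(a - b) * u, ?_⟩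
    linear_combination -a * huv
  have hc2 : b * (u * M) + a * (v * p) ≡ b [ZMOD p] := by
    refine (Int.modEq_iff_dvd).2 ⟨(b - a) * v, ?_⟩
    linear_combination -b * huv
  refine ⟨b * (u * M) + a * (v * p), fun n => ?_⟩
  push_cast
  rw [← Int.modEq_and_modEq_iff_modEq_mul
    (by simpa using ((Nat.Prime.coprime_iff_not_dvd hp).2 hM).symm)]
  exact ⟨fun h => ⟨h.1.trans hc1, h.2.trans hc2⟩, fun h => ⟨h.1.trans hc1.symm, h.2.trans hc2.symm⟩⟩

/-- Sums over the `n ≡ a (mod M)` for which each prime of `U` divides some `n + h`, `h ∈ K`, reduce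
to `#K ^ #U` residue classes modulo `M * ∏ p ∈ U, p`. `Good M a` is a condition on residue
classes (such as being coprime to the modulus) under which the sum over a class is known. -/
theorem abs_sum_filter_dvd_sub_le (w : ℕ → ℝ) (I : Finset ℕ) (K : Finset ℤ)
    (Good : ℕ → ℤ → Prop) (x E : ℝ) (U : Finset ℕ) (hU : ∀ p ∈ U, p.Prime)
    (hK : ∀ p ∈ U, ∀ h ∈ K, ∀ h' ∈ K, (p : ℤ) ∣ h - h' → h = h')
    (hGood : ∀ (M : ℕ) (a : ℤ), Good M a → ∀ p ∈ U, ∀ h ∈ K, ∀ a' : ℤ, a' ≡ a [ZMOD M] →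
      a' ≡ -h [ZMOD p] → Good (M * p) a')
    (M : ℕ) (a : ℤ) (hM : ∀ p ∈ U, ¬p ∣ M) (ha : Good M a)
    (hE : ∀ a' : ℤ, Good (M * ∏ p ∈ U, p) a' →
      |∑ n ∈ I with ((n : ℕ) : ℤ) ≡ a' [ZMOD (M * ∏ p ∈ U, p : ℕ)], w n - x| ≤ E) :
    |∑ n ∈ I with ((n : ℕ) : ℤ) ≡ a [ZMOD M] ∧ ∀ p ∈ U, ∃ h ∈ K, (p : ℤ) ∣ n + h, w n -
      (K.card : ℝ) ^ U.card * x| ≤ (K.card : ℝ) ^ U.card * E := by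
  induction U using Finset.induction_on generalizing M a with
  | empty => simpa using hE a (by simpa using ha)
  | insert p U hpU ih =>
    have hp : p.Prime := hU p (mem_insert_self p U)
    choose c hc using fun h : ℤ => exists_crt hp (hM p (mem_insert_self p U)) a (-h)
    have hdvd : ∀ (n : ℕ) (h : ℤ), (p : ℤ) ∣ n + h ↔ (n : ℤ) ≡ -h [ZMOD p] := by
      intro n h
      rw [Int.modEq_comm, Int.modEq_iff_dvd, sub_neg_eq_add]
    have hsplit : ∑ n ∈ I with ((n : ℕ) : ℤ) ≡ a [ZMOD M] ∧
          ∀ q ∈ insert p U, ∃ h ∈ K, (q : ℤ) ∣ n + h, w n =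
        ∑ h ∈ K, ∑ n ∈ I with ((n : ℕ) : ℤ) ≡ c h [ZMOD (M * p : ℕ)] ∧
          ∀ q ∈ U, ∃ h ∈ K, (q : ℤ) ∣ n + h, w n := by
      simp only [sum_filter]
      rw [sum_comm]
      refine sum_congr rfl fun n _ => ?_
      simp only [hc, ← hdvd, forall_mem_insert]
      by_cases h1 : (n : ℤ) ≡ a [ZMOD M] ∧ ∀ q ∈ U, ∃ h ∈ K, (q : ℤ) ∣ n + h
      · by_cases h2 : ∃ h ∈ K, (p : ℤ) ∣ n + h
        · obtain ⟨h, hhK, hh⟩ := h2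
          rw [if_pos ⟨h1.1, ⟨h, hhK, hh⟩, h1.2⟩, sum_eq_single_of_mem h hhK,
            if_pos ⟨⟨h1.1, hh⟩, h1.2⟩]
          intro h' hh'K hne
          rw [if_neg]
          rintro ⟨⟨-, h3⟩, -⟩
          refine hne (hK p (mem_insert_self p U) h' hh'K h hhK ?_)
          have := dvd_sub h3 hh
          simpa using this
        · rw [if_neg fun h => h2 h.2.1]
          symm
          refine sum_eq_zero fun h hhK => if_neg fun h3 => h2 ⟨h, hhK, h3.1.2⟩
      · rw [if_neg fun h => h1 ⟨h.1, h.2.2⟩]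
        symm
        exact sum_eq_zero fun h hhK => if_neg fun h3 => h1 ⟨h3.1.1, h3.2⟩
    have hmod : M * p * ∏ q ∈ U, q = M * ∏ q ∈ insert p U, q := by
      rw [prod_insert hpU, mul_assoc]
    have hterm : ∀ h ∈ K, |∑ n ∈ I with ((n : ℕ) : ℤ) ≡ c h [ZMOD (M * p : ℕ)] ∧
          ∀ q ∈ U, ∃ h ∈ K, (q : ℤ) ∣ n + h, w n - (K.card : ℝ) ^ U.card * x| ≤
        (K.card : ℝ) ^ U.card * E := by
      intro h hhK
      have hch := (hc h (c h)).1 (Int.ModEq.refl _)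
      refine ih (fun q hq => hU q (mem_insert_of_mem hq))
        (fun q hq => hK q (mem_insert_of_mem hq))
        (fun M a hMa q hq => hGood M a hMa q (mem_insert_of_mem hq)) (M * p) (c h) ?_ ?_ ?_
      · intro q hq hdiv
        have hq' := hU q (mem_insert_of_mem hq)
        rcases (Nat.Prime.dvd_mul hq').1 hdiv with h1 | h1
        · exact hM q (mem_insert_of_mem hq) h1
        · rw [Nat.prime_dvd_prime_iff_eq hq' hp] at h1
          exact hpU (h1 ▸ hq)
      · exact hGood M a ha p (mem_insert_self p U) h hhK _ hch.1 hch.2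
      · rw [hmod]; exact hE
    rw [hsplit, card_insert_of_notMem hpU]
    have hx : (K.card : ℝ) ^ (U.card + 1) * x = ∑ h ∈ K, (K.card : ℝ) ^ U.card * x := by
      rw [sum_const, nsmul_eq_mul]; ring
    have hEE : (K.card : ℝ) ^ (U.card + 1) * E = ∑ h ∈ K, (K.card : ℝ) ^ U.card * E := by
      rw [sum_const, nsmul_eq_mul]; ring
    rw [hx, hEE, ← sum_sub_distrib]
    exact (abs_sum_le_sum_abs _ _).trans (sum_le_sum hterm)

/-- The sum of `lam S` over the subsets `S` of `P` all of whose primes divide `∏ h ∈ K, (n + h)`. -/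
noncomputable def sieveSum (P : Finset ℕ) (K : Finset ℤ) (lam : Finset ℕ → ℝ) (n : ℕ) : ℝ :=
  ∑ S ∈ P.powerset.filter fun S : Finset ℕ => ∀ p ∈ S, ∃ h ∈ K, (p : ℤ) ∣ n + h, lam S

/-- Expanding the square of the sieve sum gives a quadratic form, when sums over the multiples of
each `∏ p ∈ U, p` are known up to an error `E U`. -/
theorem abs_sum_mul_sieveSum_sq_sub_le (P : Finset ℕ) (K : Finset ℤ) (lam : Finset ℕ → ℝ)
    (w : ℕ → ℝ) (I : Finset ℕ) (M : ℕ) (a : ℤ) (g : ℕ → ℝ) (X : ℝ) (E : Finset ℕ → ℝ)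
    (hE : ∀ U ⊆ P, |∑ n ∈ I with ((n : ℕ) : ℤ) ≡ a [ZMOD M] ∧
      ∀ p ∈ U, ∃ h ∈ K, (p : ℤ) ∣ n + h, w n - X * ∏ p ∈ U, g p| ≤ E U) :
    |∑ n ∈ I with ((n : ℕ) : ℤ) ≡ a [ZMOD M], w n * sieveSum P K lam n ^ 2 -
      X * ∑ S ∈ P.powerset, ∑ T ∈ P.powerset, lam S * lam T * ∏ p ∈ S ∪ T, g p| ≤
      ∑ S ∈ P.powerset, ∑ T ∈ P.powerset, |lam S| * |lam T| * E (S ∪ T) := by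
  have h1 : ∑ n ∈ I with ((n : ℕ) : ℤ) ≡ a [ZMOD M], w n * sieveSum P K lam n ^ 2 =
      ∑ S ∈ P.powerset, ∑ T ∈ P.powerset, lam S * lam T *
        ∑ n ∈ I with ((n : ℕ) : ℤ) ≡ a [ZMOD M] ∧
          ∀ p ∈ S ∪ T, ∃ h ∈ K, (p : ℤ) ∣ n + h, w n := by
    have h2 : ∀ n : ℕ, w n * sieveSum P K lam n ^ 2 = ∑ S ∈ P.powerset, ∑ T ∈ P.powerset,
        lam S * lam T * (if ∀ p ∈ S ∪ T, ∃ h ∈ K, (p : ℤ) ∣ n + h then w n else 0) := by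
      intro n
      rw [sieveSum, sq, sum_filter, sum_mul_sum, mul_sum]
      refine sum_congr rfl fun S _ => ?_
      rw [mul_sum]
      refine sum_congr rfl fun T _ => ?_
      simp only [mem_union, or_imp, forall_and]
      by_cases hS : ∀ p ∈ S, ∃ h ∈ K, (p : ℤ) ∣ n + h
      · by_cases hT : ∀ p ∈ T, ∃ h ∈ K, (p : ℤ) ∣ n + h
        · rw [if_pos hS, if_pos hT, if_pos ⟨hS, hT⟩]; ring
        · rw [if_neg hT, if_neg (not_and_of_not_right _ hT)]; ring
      · rw [if_neg hS, if_neg (not_and_of_not_left _ hS)]; ring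
    rw [sum_congr rfl fun n _ => h2 n, sum_comm]
    refine sum_congr rfl fun S _ => ?_
    rw [sum_comm]
    refine sum_congr rfl fun T _ => ?_
    rw [← mul_sum, ← sum_filter, filter_filter]
  rw [h1, mul_sum, ← sum_sub_distrib]
  refine (abs_sum_le_sum_abs _ _).trans (sum_le_sum fun S hS => ?_)
  rw [mul_sum, ← sum_sub_distrib]
  refine (abs_sum_le_sum_abs _ _).trans (sum_le_sum fun T hT => ?_)
  rw [mem_powerset] at hS hT
  have := hE (S ∪ T) (union_subset hS hT)
  rw [show ∀ y z : ℝ, lam S * lam T * y - X * (lam S * lam T * z) =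
    lam S * lam T * (y - X * z) from fun y z => by ring, abs_mul, abs_mul]
  gcongr

/-! ### Sums of the squared sieve weights over integers and over primes -/

theorem abs_card_modEq_sub_le {A B : ℕ} (hAB : A ≤ B) {q : ℕ} (hq : 0 < q) (a : ℤ) :
    |(#{n ∈ Ioc A B | ((n : ℕ) : ℤ) ≡ a [ZMOD q]} : ℝ) - ((B : ℝ) - A) / q| ≤ 1 := by
  have hq0 : (0 : ℤ) < q := by exact_mod_cast hq
  have hqQ : (0 : ℚ) < q := by exact_mod_cast hq
  have h1 : #{n ∈ Ioc A B | ((n : ℕ) : ℤ) ≡ a [ZMOD q]} =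
      #{x ∈ Ioc (A : ℤ) (B : ℤ) | x ≡ a [ZMOD (q : ℤ)]} := by
    rw [← card_map (Nat.castEmbedding (R := ℤ))]
    congr 1
    ext x
    simp only [mem_map, mem_filter, mem_Ioc, Nat.castEmbedding_apply]
    constructor
    · rintro ⟨y, ⟨⟨h1, h2⟩, h3⟩, rfl⟩
      exact ⟨⟨by exact_mod_cast h1, by exact_mod_cast h2⟩, h3⟩
    · rintro ⟨⟨h1, h2⟩, h3⟩
      lift x to ℕ using by omega
      exact ⟨x, ⟨⟨by exact_mod_cast h1, by exact_mod_cast h2⟩, h3⟩, rfl⟩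
  have h2 := Int.Ioc_filter_modEq_card (A : ℤ) B hq0 a
  rw [← h1] at h2
  set u : ℚ := ((B : ℤ) - a) / ((q : ℤ) : ℚ) with hu
  set v : ℚ := ((A : ℤ) - a) / ((q : ℤ) : ℚ) with hv
  have huv : v ≤ u := by
    rw [hu, hv]
    have : (A : ℚ) ≤ B := by exact_mod_cast hAB
    push_cast
    gcongr
  rw [max_eq_left (by linarith [Int.floor_mono huv])] at h2
  have h3 : (#{n ∈ Ioc A B | ((n : ℕ) : ℤ) ≡ a [ZMOD q]} : ℚ) = (⌊u⌋ : ℚ) - ⌊v⌋ := by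
    exact_mod_cast h2
  have h4 : u - v = ((B : ℚ) - A) / q := by
    rw [hu, hv, ← sub_div]; push_cast; ring
  have h5 : |(#{n ∈ Ioc A B | ((n : ℕ) : ℤ) ≡ a [ZMOD q]} : ℚ) - ((B : ℚ) - A) / q| ≤ 1 := by
    rw [h3, ← h4, abs_le]
    have := Int.floor_le u
    have := Int.floor_le v
    have := Int.lt_floor_add_one u
    have := Int.lt_floor_add_one v
    constructor <;> linarith
  have h6 := (Rat.cast_le (K := ℝ)).2 h5
  push_cast at h6
  exact h6

/-- The sum of the squares of the sieve weights over an interval in a residue class. -/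
theorem abs_sum_sieveSum_sq_sub_le (P : Finset ℕ) (hP : ∀ p ∈ P, p.Prime) (H : Finset ℤ)
    (hH : ∀ p ∈ P, ∀ h ∈ H, ∀ h' ∈ H, (p : ℤ) ∣ h - h' → h = h') (W : ℕ) (hW : 0 < W)
    (hPW : ∀ p ∈ P, ¬p ∣ W) (lam : Finset ℕ → ℝ) {A B : ℕ} (hAB : A ≤ B) (a : ℤ) :
    |∑ n ∈ Ioc A B with ((n : ℕ) : ℤ) ≡ a [ZMOD W], sieveSum P H lam n ^ 2 -
      ((B : ℝ) - A) / W * ∑ S ∈ P.powerset, ∑ T ∈ P.powerset, lam S * lam T *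
        ∏ p ∈ S ∪ T, (H.card : ℝ) / p| ≤
      ∑ S ∈ P.powerset, ∑ T ∈ P.powerset, |lam S| * |lam T| * (H.card : ℝ) ^ (S ∪ T).card := by
  have h := abs_sum_mul_sieveSum_sq_sub_le P H lam (fun _ => 1) (Ioc A B) W a
    (fun p : ℕ => (H.card : ℝ) / p) (((B : ℝ) - A) / W) (fun U => (H.card : ℝ) ^ U.card) (by
      intro U hU
      have hUp : ∀ p ∈ U, p.Prime := fun p hp => hP p (hU hp)
      have h1 := abs_sum_filter_dvd_sub_le (fun _ => 1) (Ioc A B) H (fun _ _ => True)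
        (((B : ℝ) - A) / (W * ∏ p ∈ U, p : ℕ)) 1 U hUp (fun p hp => hH p (hU hp))
        (fun _ _ _ _ _ _ _ _ _ _ => trivial) W a (fun p hp => hPW p (hU hp)) trivial
        (fun a' _ => by
          have := abs_card_modEq_sub_le hAB (Nat.mul_pos hW (prod_pos_of_prime hUp)) a'
          simpa using this)
      rw [mul_one] at h1
      refine le_trans (le_of_eq ?_) h1
      congr 2
      push_cast
      rw [prod_div_distrib, prod_const]
      ring)
  simpa only [one_mul] using h

/-- The weight of `n` in the sums over primes: `varpi (n + h)` when `n + h` lies in `(N, 2 N]`. -/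
noncomputable def primeWeight (N : ℕ) (h : ℤ) (n : ℕ) : ℝ :=
  if (N : ℤ) < n + h ∧ (n : ℤ) + h ≤ 2 * N then varpi ((n : ℤ) + h).toNat else 0

theorem abs_sum_primeWeight_sub_le {N A B : ℕ} {h : ℤ} (hA : (A : ℤ) + h ≤ N)
    (hB : 2 * (N : ℤ) ≤ B + h) (hAN : h ≤ N) {q : ℕ} (hq : 0 < q) (a : ℤ)
    (ha : IsCoprime (a + h) (q : ℤ)) :
    |∑ n ∈ Ioc A B with ((n : ℕ) : ℤ) ≡ a [ZMOD q], primeWeight N h n -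
      (N : ℝ) / (q.totient : ℝ)| ≤ maxError N q := by
  have hq0 : (0 : ℤ) < q := by exact_mod_cast hq
  set b : ℕ := ((a + h) % q).toNat with hb
  have hb' : (b : ℤ) = (a + h) % q := Int.toNat_of_nonneg (Int.emod_nonneg _ hq0.ne')
  have hbmod : (b : ℤ) ≡ a + h [ZMOD q] := by rw [hb']; exact Int.mod_modEq _ _
  have hbcop : b.Coprime q := by
    rw [← Nat.isCoprime_iff_coprime]
    obtain ⟨c, hc⟩ := (Int.modEq_iff_dvd.1 hbmod)
    have : (b : ℤ) = a + h + q * (-c) := by linarith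
    rw [this]
    exact ha.add_mul_left_left (-c)
  have hsum : ∑ n ∈ Ioc A B with ((n : ℕ) : ℤ) ≡ a [ZMOD q], primeWeight N h n =
      thetaStar N b q := by
    have hfl : ⌊(2 : ℝ) * (N : ℝ)⌋₊ = 2 * N := by
      rw [show (2 : ℝ) * (N : ℝ) = ((2 * N : ℕ) : ℝ) by push_cast; ring, Nat.floor_natCast]
    rw [thetaStar, Nat.floor_natCast, hfl]
    unfold primeWeight
    rw [← sum_filter, filter_filter]
    refine sum_bij' (fun n _ => ((n : ℤ) + h).toNat) (fun m _ => ((m : ℤ) - h).toNat)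
      ?_ ?_ ?_ ?_ ?_
    · intro n hn
      simp only [mem_filter, mem_Ioc] at hn ⊢
      obtain ⟨⟨h1, h2⟩, h3, h4, h5⟩ := hn
      refine ⟨by omega, ?_⟩
      rw [← Int.natCast_modEq_iff, Int.toNat_of_nonneg (by omega)]
      exact (h3.add_right h).trans hbmod.symm
    · intro m hm
      simp only [mem_filter, mem_Ioc] at hm ⊢
      obtain ⟨⟨h1, h2⟩, h3⟩ := hm
      have h4 : (((m : ℤ) - h).toNat : ℤ) = m - h := Int.toNat_of_nonneg (by omega)
      refine ⟨by omega, ?_, by omega, by omega⟩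
      rw [h4]
      have := ((Int.natCast_modEq_iff.2 h3).trans hbmod).sub_right h
      simpa using this
    · intro n hn
      simp only [mem_filter, mem_Ioc] at hn
      omega
    · intro m hm
      simp only [mem_filter, mem_Ioc] at hm
      omega
    · intro n hn; rfl
  rw [hsum]
  exact le_csSup (errorSet_bddAbove _ _)
    ⟨N, Nat.cast_nonneg N, le_rfl, b, hbcop, rfl⟩

theorem totient_prod_primes {U : Finset ℕ} (hU : ∀ p ∈ U, p.Prime) :
    ((∏ p ∈ U, p).totient : ℝ) = ∏ p ∈ U, ((p : ℝ) - 1) := by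
  induction U using Finset.induction_on with
  | empty => simp
  | insert p U hp ih =>
    have hpp := hU p (mem_insert_self p U)
    have hcop : p.Coprime (∏ q ∈ U, q) := by
      refine Nat.Coprime.prod_right fun q hq => ?_
      rw [Nat.coprime_primes hpp (hU q (mem_insert_of_mem hq))]
      rintro rfl; exact hp hq
    rw [prod_insert hp, prod_insert hp, Nat.totient_mul hcop, Nat.totient_prime hpp]
    push_cast [hpp.one_le]
    rw [ih fun q hq => hU q (mem_insert_of_mem hq)]

theorem totient_mul_prod_primes {U : Finset ℕ} (hU : ∀ p ∈ U, p.Prime) {W : ℕ}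
    (hUW : ∀ p ∈ U, ¬p ∣ W) :
    ((W * ∏ p ∈ U, p).totient : ℝ) = W.totient * ∏ p ∈ U, ((p : ℝ) - 1) := by
  rw [Nat.totient_mul, Nat.cast_mul, totient_prod_primes hU]
  exact Nat.Coprime.prod_right fun q hq =>
    ((Nat.Prime.coprime_iff_not_dvd (hU q hq)).2 (hUW q hq)).symm

/-- The sum of the squares of the sieve weights over the `n` for which `n + h₀` is prime. -/
theorem abs_sum_primeWeight_mul_sieveSum_sq_sub_le (P : Finset ℕ) (hP : ∀ p ∈ P, p.Prime)
    (H : Finset ℤ) (hH : ∀ p ∈ P, ∀ h ∈ H, ∀ h' ∈ H, (p : ℤ) ∣ h - h' → h = h') (W : ℕ)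
    (hW : 0 < W) (hPW : ∀ p ∈ P, ¬p ∣ W) (lam : Finset ℕ → ℝ) {N A B : ℕ} {h₀ : ℤ} (hh₀ : h₀ ∈ H)
    (hA : (A : ℤ) + h₀ ≤ N) (hB : 2 * (N : ℤ) ≤ B + h₀) (hAN : h₀ ≤ N) (hPN : ∀ p ∈ P, p ≤ N)
    (a : ℤ) (ha : IsCoprime (a + h₀) (W : ℤ)) :
    |∑ n ∈ Ioc A B with ((n : ℕ) : ℤ) ≡ a [ZMOD W], primeWeight N h₀ n * sieveSum P H lam n ^ 2 -
      (N : ℝ) / W.totient * ∑ S ∈ P.powerset, ∑ T ∈ P.powerset, lam S * lam T *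
        ∏ p ∈ S ∪ T, ((H.card : ℝ) - 1) / (p - 1)| ≤
      ∑ S ∈ P.powerset, ∑ T ∈ P.powerset, |lam S| * |lam T| *
        (((H.card : ℝ) - 1) ^ (S ∪ T).card * maxError N (W * ∏ p ∈ S ∪ T, p)) := by
  set K := H.erase h₀ with hK
  have hKcard : (K.card : ℝ) = (H.card : ℝ) - 1 := by
    rw [hK, card_erase_of_mem hh₀, Nat.cast_sub (card_pos.2 ⟨h₀, hh₀⟩), Nat.cast_one]
  -- a prime `n + h₀` exceeding `N` has no factor in `P`
  have hswap : ∀ n : ℕ, primeWeight N h₀ n * sieveSum P H lam n ^ 2 =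
      primeWeight N h₀ n * sieveSum P K lam n ^ 2 := by
    intro n
    by_cases h0 : primeWeight N h₀ n = 0
    · rw [h0, zero_mul, zero_mul]
    · have h1 : (N : ℤ) < n + h₀ ∧ ((n : ℤ) + h₀).toNat.Prime := by
        unfold primeWeight varpi at h0
        split_ifs at h0 with h1 h2
        · exact ⟨h1.1, h2⟩
        · exact absurd rfl h0
        · exact absurd rfl h0
      have h2 : ∀ p ∈ P, ¬((p : ℤ) ∣ n + h₀) := by
        intro p hp hdvd
        have h3 : (((n : ℤ) + h₀).toNat : ℤ) = n + h₀ := Int.toNat_of_nonneg (by omega)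
        rw [← h3, Int.natCast_dvd_natCast, Nat.prime_dvd_prime_iff_eq (hP p hp) h1.2] at hdvd
        have := hPN p hp
        omega
      have h3 : sieveSum P H lam n = sieveSum P K lam n := by
        unfold sieveSum
        refine sum_congr (filter_congr fun S hS => ?_) fun _ _ => rfl
        rw [mem_powerset] at hS
        refine forall₂_congr fun p hp => ⟨?_, ?_⟩
        · rintro ⟨h, hh, hd⟩
          refine ⟨h, mem_erase.2 ⟨?_, hh⟩, hd⟩
          rintro rfl
          exact h2 p (hS hp) hd
        · rintro ⟨h, hh, hd⟩
          exact ⟨h, mem_of_mem_erase hh, hd⟩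
      rw [h3]
  rw [sum_congr rfl fun n _ => hswap n, ← hKcard]
  refine abs_sum_mul_sieveSum_sq_sub_le P K lam (primeWeight N h₀) (Ioc A B) W a
    (fun p : ℕ => (K.card : ℝ) / ((p : ℝ) - 1)) ((N : ℝ) / W.totient)
    (fun U => (K.card : ℝ) ^ U.card * maxError N (W * ∏ p ∈ U, p)) ?_
  intro U hU
  have hUp : ∀ p ∈ U, p.Prime := fun p hp => hP p (hU hp)
  have h1 := abs_sum_filter_dvd_sub_le (primeWeight N h₀) (Ioc A B) K
    (fun M a => IsCoprime (a + h₀) (M : ℤ))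
    ((N : ℝ) / ((W * ∏ p ∈ U, p).totient : ℝ)) (maxError N (W * ∏ p ∈ U, p)) U hUp
    (fun p hp h hh h' hh' => hH p (hU hp) h (mem_of_mem_erase hh) h' (mem_of_mem_erase hh'))
    (by
      intro M a hMa p hp h hh a' h1 h2
      push_cast
      refine IsCoprime.mul_right ?_ ?_
      · obtain ⟨c, hc⟩ := Int.modEq_iff_dvd.1 h1
        have : a' + h₀ = a + h₀ + M * (-c) := by linarith
        rw [this]
        exact hMa.add_mul_left_left (-c)
      · refine ((Nat.prime_iff_prime_int.1 (hUp p hp)).irreducible.coprime_iff_not_dvd.2 ?_).symm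
        intro hd
        obtain ⟨c, hc⟩ := Int.modEq_iff_dvd.1 h2
        have h3 : (p : ℤ) ∣ h₀ - h := by
          have : h₀ - h = (a' + h₀) + (-h - a') := by ring
          rw [this, hc]
          exact dvd_add hd (dvd_mul_right _ _)
        exact (mem_erase.1 hh).1 (hH p (hU hp) h₀ hh₀ h (mem_of_mem_erase hh) h3).symm)
    W a (fun p hp => hPW p (hU hp)) ha
    (fun a' ha' => abs_sum_primeWeight_sub_le hA hB hAN
      (Nat.mul_pos hW (prod_pos_of_prime hUp)) a' ha')
  refine le_trans (le_of_eq ?_) h1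
  congr 2
  rw [totient_mul_prod_primes hUp fun p hp => hPW p (hU hp), prod_div_distrib, prod_const]
  ring

/-! ### Error terms -/

/-- The subsets of `P` whose product is less than `exp t`. -/
noncomputable def smallSubsets (P : Finset ℕ) (t : ℝ) : Finset (Finset ℕ) :=
  P.powerset.filter fun U : Finset ℕ => ∑ p ∈ U, Real.log p < t

theorem mem_smallSubsets {P U : Finset ℕ} {t : ℝ} :
    U ∈ smallSubsets P t ↔ U ⊆ P ∧ ∑ p ∈ U, Real.log (p : ℝ) < t := by
  rw [smallSubsets, mem_filter, mem_powerset]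

theorem prod_le_floor_exp {P U : Finset ℕ} (hP : ∀ p ∈ P, p.Prime) {t : ℝ}
    (hU : U ∈ smallSubsets P t) : ((∏ p ∈ U, p : ℕ) : ℝ) < Real.exp t := by
  rw [mem_smallSubsets] at hU
  have hUp : ∀ p ∈ U, p.Prime := fun p hp => hP p (hU.1 hp)
  rw [← Real.log_lt_iff_lt_exp (by exact_mod_cast prod_pos_of_prime hUp), log_prod_primes hUp]
  exact hU.2

theorem sum_smallSubsets_prod_inv_le {P : Finset ℕ} (hP : ∀ p ∈ P, p.Prime) {t : ℝ} (ht : 0 ≤ t) :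
    ∑ U ∈ smallSubsets P t, ∏ p ∈ U, (p : ℝ)⁻¹ ≤ 1 + t := by
  set X := ⌊Real.exp t⌋₊ with hX
  have hX1 : 1 ≤ X := (Nat.one_le_floor_iff _).2 (Real.one_le_exp ht)
  calc _ = ∑ n ∈ (smallSubsets P t).image (fun T : Finset ℕ => ∏ p ∈ T, p), (n : ℝ)⁻¹ := by
        rw [sum_image ((injOn_prod_primes hP).mono fun U hU => (mem_smallSubsets.1 hU).1)]
        refine sum_congr rfl fun U _ => ?_
        push_cast
        rw [prod_inv_distrib]
    _ ≤ ∑ n ∈ Icc 1 X, (n : ℝ)⁻¹ := by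
        refine sum_le_sum_of_subset_of_nonneg (fun n hn => ?_) fun n _ _ => by positivity
        obtain ⟨U, hU, rfl⟩ := mem_image.1 hn
        rw [mem_Icc]
        exact ⟨prod_pos_of_prime fun p hp => hP p ((mem_smallSubsets.1 hU).1 hp),
          Nat.le_floor (prod_le_floor_exp hP hU).le⟩
    _ ≤ 1 + Real.log X := by
        have := harmonic_le_one_add_log X
        rw [harmonic_eq_sum_Icc] at this
        push_cast at this
        exact this
    _ ≤ _ := by
        have : Real.log X ≤ t := by
          rw [Real.log_le_iff_le_exp (by exact_mod_cast hX1)]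
          exact Nat.floor_le (Real.exp_pos t).le
        linarith

/-- The analogue of `∑ c ^ ω(d) / d ≪ (log x) ^ c` for squarefree `d ≤ x`. -/
theorem sum_smallSubsets_prod_div_le {P : Finset ℕ} (hP : ∀ p ∈ P, p.Prime) {t : ℝ} (ht : 0 ≤ t)
    (c : ℕ) : ∑ U ∈ smallSubsets P t, ∏ p ∈ U, (c : ℝ) / p ≤ (1 + t) ^ c := by
  induction c with
  | zero =>
    have h1 : ∀ U ∈ smallSubsets P t, ∏ p ∈ U, ((0 : ℕ) : ℝ) / p = if U = ∅ then 1 else 0 := by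
      intro U _
      split_ifs with h
      · simp [h]
      · obtain ⟨p, hp⟩ := nonempty_iff_ne_empty.2 h
        exact prod_eq_zero hp (by simp)
    rw [sum_congr rfl h1, sum_ite_eq', pow_zero]
    split_ifs <;> simp
  | succ c ih =>
    have h1 : ∑ U ∈ smallSubsets P t, ∏ p ∈ U, ((c + 1 : ℕ) : ℝ) / p =
        ∑ U ∈ P.powerset, (∏ p ∈ U, ((c : ℝ) / p + (p : ℝ)⁻¹)) *
          (if ∑ p ∈ U, Real.log (p : ℝ) < t then 1 else 0) := by
      rw [smallSubsets, sum_filter]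
      refine sum_congr rfl fun U _ => ?_
      rw [mul_ite, mul_one, mul_zero]
      congr 1
      refine prod_congr rfl fun p _ => ?_
      push_cast
      rw [add_div, one_div]
    rw [h1, sum_powerset_prod_add, pow_succ]
    calc _ ≤ ∑ S ∈ smallSubsets P t, (∏ p ∈ S, (c : ℝ) / p) * (1 + t) := by
          rw [smallSubsets, sum_filter]
          refine sum_le_sum fun S hS => ?_
          have hprod : 0 ≤ ∏ p ∈ S, (c : ℝ) / p := prod_nonneg fun p _ => by positivity
          split_ifs with h
          · refine mul_le_mul_of_nonneg_left ?_ hprod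
            refine le_trans ?_ (sum_smallSubsets_prod_inv_le hP ht)
            rw [smallSubsets, sum_filter]
            calc _ ≤ ∑ T ∈ (P \ S).powerset,
                  if ∑ p ∈ T, Real.log (p : ℝ) < t then ∏ p ∈ T, (p : ℝ)⁻¹ else 0 := by
                  refine sum_le_sum fun T hT => ?_
                  rw [sum_union (disjoint_of_mem_powerset_sdiff hT), mul_ite, mul_one, mul_zero]
                  have h2 : 0 ≤ ∏ p ∈ T, (p : ℝ)⁻¹ := prod_nonneg fun p _ => by positivity
                  have h3 := sum_log_nonneg S
                  split_ifs with h4 h5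
                  · exact le_rfl
                  · exact absurd (by linarith) h5
                  · exact h2
                  · exact le_rfl
              _ ≤ _ := by
                  refine sum_le_sum_of_subset_of_nonneg (powerset_mono.2 sdiff_subset)
                    fun T _ _ => ?_
                  split_ifs
                  · exact prod_nonneg fun p _ => by positivity
                  · exact le_rfl
          · refine le_of_eq ?_
            rw [sum_eq_zero, mul_zero]
            intro T hT
            rw [if_neg, mul_zero]
            rw [sum_union (disjoint_of_mem_powerset_sdiff hT)]
            linarith [sum_log_nonneg T]
      _ ≤ _ := by
          rw [← sum_mul]
          exact mul_le_mul_of_nonneg_right ih (by linarith)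

theorem gpyWeight_eq_zero {P S : Finset ℕ} {k t : ℝ} (hS : t ≤ ∑ p ∈ S, Real.log (p : ℝ)) :
    gpyWeight P k t S = 0 := by
  rw [gpyWeight, selbergWeight, sum_eq_zero, mul_zero]
  intro T hT
  rw [ell_union (disjoint_of_mem_powerset_sdiff hT), ell, max_eq_right, mul_zero]
  linarith [sum_log_nonneg T]

/-- The weights are bounded by a divisor-type function times a power of `1 + t`, by
`p / (p - k) ≤ 2` and `k / (p - k) ≤ 2 k / p`. -/
theorem abs_gpyWeight_le {P S : Finset ℕ} (hP : ∀ p ∈ P, p.Prime) (hS : S ⊆ P) {k : ℕ}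
    (hk : 0 < k) (hPk : ∀ p ∈ P, 2 * (k : ℝ) ≤ p) {t : ℝ} (ht : 0 ≤ t) :
    |gpyWeight P k t S| ≤ 2 ^ S.card * (t * (1 + t) ^ (2 * k)) := by
  have hk0 : (0 : ℝ) < k := by exact_mod_cast hk
  have hp0 : ∀ p ∈ P, (0 : ℝ) < p := fun p hp => by linarith [hPk p hp]
  have hpk : ∀ p ∈ P, 0 < (p : ℝ) - k := fun p hp => by linarith [hPk p hp]
  have hw : ∀ T ⊆ P, 0 ≤ ∏ p ∈ T, (k : ℝ) / (p - k) := fun T hT =>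
    prod_nonneg fun p hp => (div_pos hk0 (hpk p (hT hp))).le
  have h1 : 0 ≤ ∑ T ∈ (P \ S).powerset, (∏ p ∈ T, (k : ℝ) / (p - k)) * ell t (S ∪ T) :=
    sum_nonneg fun T hT => mul_nonneg (hw T ((mem_powerset.1 hT).trans sdiff_subset))
      (ell_nonneg _ _)
  have h2 : gpyWeight P k t S = (∏ p ∈ S, (-((p : ℝ) / (p - k)))) *
      ∑ T ∈ (P \ S).powerset, (∏ p ∈ T, (k : ℝ) / (p - k)) * ell t (S ∪ T) := by
    have h3 : ∏ p ∈ S, (-((p : ℝ) / (p - k))) =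
        (∏ p ∈ S, (-((p : ℝ) / k))) * ∏ p ∈ S, (k : ℝ) / (p - k) := by
      rw [← prod_mul_distrib]
      refine prod_congr rfl fun p _ => ?_
      field_simp
    rw [gpyWeight, selbergWeight, h3, mul_assoc]
    congr 1
    rw [mul_sum]
    refine sum_congr rfl fun T hT => ?_
    rw [prod_union (disjoint_of_mem_powerset_sdiff hT), mul_assoc]
  rw [h2, abs_mul, abs_of_nonneg h1, abs_prod]
  refine mul_le_mul ?_ ?_ h1 (by positivity)
  · rw [← prod_const]
    refine prod_le_prod (fun p _ => abs_nonneg _) fun p hp => ?_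
    rw [abs_neg, abs_of_nonneg (div_pos (hp0 p (hS hp)) (hpk p (hS hp))).le,
      div_le_iff₀ (hpk p (hS hp))]
    linarith [hPk p (hS hp)]
  · calc _ ≤ ∑ T ∈ (P \ S).powerset,
          if ∑ p ∈ T, Real.log (p : ℝ) < t then (∏ p ∈ T, ((2 * k : ℕ) : ℝ) / p) * t else 0 := by
          refine sum_le_sum fun T hT => ?_
          have hTP : T ⊆ P := (mem_powerset.1 hT).trans sdiff_subset
          have hell : ell t (S ∪ T) ≤ ell t T := by
            rw [ell_union (disjoint_of_mem_powerset_sdiff hT)]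
            exact ell_anti_left (by linarith [sum_log_nonneg S]) T
          split_ifs with h
          · refine mul_le_mul ?_ ((ell_le _).trans (max_eq_left ht).le) (ell_nonneg _ _)
              (prod_nonneg fun p _ => by positivity)
            refine prod_le_prod (fun p hp => (div_pos hk0 (hpk p (hTP hp))).le) fun p hp => ?_
            rw [div_le_div_iff₀ (hpk p (hTP hp)) (hp0 p (hTP hp))]
            push_cast
            have := hPk p (hTP hp)
            nlinarith
          · have h0 : ell t T = 0 := max_eq_right (by linarith)
            have h00 : ell t (S ∪ T) = 0 := le_antisymm (hell.trans h0.le) (ell_nonneg _ _)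
            rw [h00, mul_zero]
      _ ≤ ∑ T ∈ P.powerset,
          if ∑ p ∈ T, Real.log (p : ℝ) < t then (∏ p ∈ T, ((2 * k : ℕ) : ℝ) / p) * t else 0 := by
          refine sum_le_sum_of_subset_of_nonneg (powerset_mono.2 sdiff_subset) fun T _ _ => ?_
          split_ifs
          · exact mul_nonneg (prod_nonneg fun p _ => by positivity) ht
          · exact le_rfl
      _ = (∑ T ∈ smallSubsets P t, ∏ p ∈ T, ((2 * k : ℕ) : ℝ) / p) * t := by
          rw [smallSubsets, sum_mul, sum_filter]
      _ ≤ (1 + t) ^ (2 * k) * t :=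
          mul_le_mul_of_nonneg_right (sum_smallSubsets_prod_div_le hP ht _) ht
      _ = _ := mul_comm _ _

theorem sum_abs_gpyWeight_mul_le {P : Finset ℕ} (hP : ∀ p ∈ P, p.Prime) {k : ℕ}
    (hk : 0 < k) (hPk : ∀ p ∈ P, 2 * (k : ℝ) ≤ p) {t : ℝ} (ht : 0 ≤ t) (E : Finset ℕ → ℝ)
    (hE : ∀ U, 0 ≤ E U) :
    ∑ S ∈ P.powerset, ∑ T ∈ P.powerset, |gpyWeight P k t S| * |gpyWeight P k t T| * E (S ∪ T) ≤
      (t * (1 + t) ^ (2 * k)) ^ 2 * ∑ U ∈ smallSubsets P (2 * t), 16 ^ U.card * E U := by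
  set Λ := t * (1 + t) ^ (2 * k) with hΛ
  have hΛ0 : 0 ≤ Λ := by positivity
  set F : Finset ℕ → ℝ := fun U =>
    if ∑ p ∈ U, Real.log (p : ℝ) < 2 * t then 4 ^ U.card * E U else 0 with hF
  have hF0 : ∀ U, 0 ≤ F U := by
    intro U
    simp only [hF]
    split_ifs
    · exact mul_nonneg (by positivity) (hE U)
    · exact le_rfl
  have h1 : ∀ S ∈ P.powerset, ∀ T ∈ P.powerset,
      |gpyWeight P k t S| * |gpyWeight P k t T| * E (S ∪ T) ≤ Λ ^ 2 * F (S ∪ T) := by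
    intro S hS T hT
    rw [mem_powerset] at hS hT
    have hr : 0 ≤ Λ ^ 2 * F (S ∪ T) := mul_nonneg (sq_nonneg _) (hF0 _)
    rcases le_or_gt t (∑ p ∈ S, Real.log (p : ℝ)) with h | h
    · rw [gpyWeight_eq_zero h]; simpa using hr
    rcases le_or_gt t (∑ p ∈ T, Real.log (p : ℝ)) with h' | h'
    · rw [gpyWeight_eq_zero h']; simpa using hr
    have h2 : ∑ p ∈ S ∪ T, Real.log (p : ℝ) < 2 * t := by
      have := sum_union_inter (s₁ := S) (s₂ := T) (f := fun p : ℕ => Real.log (p : ℝ))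
      linarith [sum_log_nonneg (S ∩ T)]
    simp only [hF, if_pos h2]
    have h3 : (2 : ℝ) ^ S.card ≤ 2 ^ (S ∪ T).card :=
      pow_le_pow_right₀ one_le_two (card_le_card subset_union_left)
    have h4 : (2 : ℝ) ^ T.card ≤ 2 ^ (S ∪ T).card :=
      pow_le_pow_right₀ one_le_two (card_le_card subset_union_right)
    have hE' := hE (S ∪ T)
    calc _ ≤ (2 ^ (S ∪ T).card * Λ) * (2 ^ (S ∪ T).card * Λ) * E (S ∪ T) := by
          gcongr
          · exact (abs_gpyWeight_le hP hS hk hPk ht).trans (by gcongr)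
          · exact (abs_gpyWeight_le hP hT hk hPk ht).trans (by gcongr)
      _ = Λ ^ 2 * ((2 * 2) ^ (S ∪ T).card * E (S ∪ T)) := by
          rw [mul_pow (2 : ℝ) 2]; ring
      _ = _ := by norm_num
  calc _ ≤ ∑ S ∈ P.powerset, ∑ T ∈ P.powerset, Λ ^ 2 * F (S ∪ T) :=
        sum_le_sum fun S hS => sum_le_sum fun T hT => h1 S hS T hT
    _ = Λ ^ 2 * ∑ S ∈ P.powerset, ∑ T ∈ P.powerset, F (S ∪ T) := by
        simp only [mul_sum]
    _ ≤ Λ ^ 2 * ∑ U ∈ P.powerset, 4 ^ U.card * F U :=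
        mul_le_mul_of_nonneg_left (sum_sum_union_le P F hF0) (sq_nonneg _)
    _ = _ := by
        rw [smallSubsets, sum_filter]
        congr 1
        refine sum_congr rfl fun U _ => ?_
        simp only [hF]
        split_ifs
        · rw [← mul_assoc, ← mul_pow]; norm_num
        · simp

theorem error_integers_le {P : Finset ℕ} (hP : ∀ p ∈ P, p.Prime) {k : ℕ}
    (hk : 0 < k) (hPk : ∀ p ∈ P, 2 * (k : ℝ) ≤ p) {t : ℝ} (ht : 0 ≤ t) :
    ∑ S ∈ P.powerset, ∑ T ∈ P.powerset, |gpyWeight P k t S| * |gpyWeight P k t T| *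
        (k : ℝ) ^ (S ∪ T).card ≤
      (t * (1 + t) ^ (2 * k)) ^ 2 * (Real.exp (2 * t) * (1 + 2 * t) ^ (16 * k)) := by
  refine (sum_abs_gpyWeight_mul_le hP hk hPk ht (fun U => (k : ℝ) ^ U.card)
    fun U => by positivity).trans ?_
  gcongr
  refine le_trans ?_ (mul_le_mul_of_nonneg_left (sum_smallSubsets_prod_div_le hP
    (by linarith : 0 ≤ 2 * t) (16 * k)) (Real.exp_pos _).le)
  rw [mul_sum]
  refine sum_le_sum fun U hU => ?_
  have h1 := (prod_le_floor_exp hP hU).le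
  have hUp : ∀ p ∈ U, p.Prime := fun p hp => hP p ((mem_smallSubsets.1 hU).1 hp)
  have h2 : (0 : ℝ) < (∏ p ∈ U, p : ℕ) := by exact_mod_cast prod_pos_of_prime hUp
  rw [prod_div_distrib, prod_const, ← mul_pow]
  push_cast at h1 h2 ⊢
  rw [← mul_div_assoc, le_div_iff₀ h2, mul_comm]
  gcongr

theorem maxError_nonneg (x : ℝ) (q : ℕ) : 0 ≤ maxError x q := by
  refine Real.sSup_nonneg fun e he => ?_
  obtain ⟨y, -, -, a, -, rfl⟩ := he
  exact abs_nonneg _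

/-- The trivial bound for the error terms. -/
theorem maxError_le {N q : ℕ} (hq : 0 < q) (hqN : q ≤ N) :
    maxError N q ≤ 3 * N * Real.log (2 * N) / q + N / q.totient := by
  have hq0 : (0 : ℝ) < q := by exact_mod_cast hq
  have hqN' : (q : ℝ) ≤ N := by exact_mod_cast hqN
  have hN1 : (1 : ℝ) ≤ N := by exact_mod_cast hq.trans_le hqN
  have hlog : 0 ≤ Real.log (2 * N) := Real.log_nonneg (by linarith)
  refine csSup_le (errorSet_nonempty (Nat.cast_nonneg N) q) ?_
  rintro e ⟨y, hy0, hyN, a, -, rfl⟩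
  have h0 : 0 ≤ thetaStar y a q := sum_nonneg fun n _ => varpi_nonneg n
  have h1 : thetaStar y a q ≤ 3 * N * Real.log (2 * N) / q := by
    have hfl : ⌊y⌋₊ ≤ ⌊2 * y⌋₊ := Nat.floor_mono (by linarith)
    have hcard := abs_card_modEq_sub_le hfl hq a
    simp only [Int.natCast_modEq_iff] at hcard
    have hcard' := (abs_le.1 hcard).2
    have hdiff : (⌊2 * y⌋₊ : ℝ) - ⌊y⌋₊ ≤ N + 1 := by
      have := Nat.floor_le (by linarith : 0 ≤ 2 * y)
      have := Nat.lt_floor_add_one y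
      linarith
    calc thetaStar y a q ≤ ∑ n ∈ (Ioc ⌊y⌋₊ ⌊2 * y⌋₊).filter (fun n => n ≡ a [MOD q]),
          Real.log (2 * N) := by
          refine sum_le_sum fun n hn => ?_
          rw [mem_filter, mem_Ioc] at hn
          unfold varpi
          split_ifs with hp
          · refine Real.log_le_log (by exact_mod_cast hp.pos) ?_
            have h3 : (n : ℝ) ≤ ⌊2 * y⌋₊ := by exact_mod_cast hn.1.2
            have := Nat.floor_le (by linarith : 0 ≤ 2 * y)
            linarith
          · exact hlog
      _ = (#((Ioc ⌊y⌋₊ ⌊2 * y⌋₊).filter (fun n => n ≡ a [MOD q])) : ℝ) * Real.log (2 * N) := by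
          rw [sum_const, nsmul_eq_mul]
      _ ≤ (3 * N / q) * Real.log (2 * N) := by
          gcongr
          have h4 : ((⌊2 * y⌋₊ : ℝ) - ⌊y⌋₊) / q ≤ (N + 1) / q := by gcongr
          have h5 : ((N : ℝ) + 1) / q + 1 ≤ 3 * N / q := by
            rw [div_add_one hq0.ne']
            gcongr
            linarith
          linarith
      _ = _ := by ring
  have h2 : 0 ≤ y / (q.totient : ℝ) := by positivity
  have h3 : y / (q.totient : ℝ) ≤ N / q.totient := by gcongr
  rw [abs_le]
  have : 0 ≤ 3 * N * Real.log (2 * N) / q := by positivity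
  constructor <;> linarith

/-- The total error in the sums over primes. The divisor-type weights are removed by
`c ≤ c ^ 2 / M + M`, with the trivial bound for the first part and the level of distribution for
the second. -/
theorem error_primes_le {P : Finset ℕ} (hP : ∀ p ∈ P, p.Prime) {k : ℕ}
    (hk : 0 < k) (hPk : ∀ p ∈ P, 2 * (k : ℝ) ≤ p) {t : ℝ} (ht : 0 ≤ t) {W : ℕ} (hW : 0 < W)
    (hPW : ∀ p ∈ P, ¬p ∣ W) {N Y : ℕ} (hY : W * Real.exp (2 * t) ≤ Y) (hYN : Y ≤ N)
    {M : ℝ} (hM : 0 < M) :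
    ∑ S ∈ P.powerset, ∑ T ∈ P.powerset, |gpyWeight P k t S| * |gpyWeight P k t T| *
        (((k : ℝ) - 1) ^ (S ∪ T).card * maxError N (W * ∏ p ∈ S ∪ T, p)) ≤
      (t * (1 + t) ^ (2 * k)) ^ 2 *
        ((3 * Real.log (2 * N) + 1) * N * (1 + 2 * t) ^ (512 * k ^ 2) / M +
          M * ∑ q ∈ Icc 1 Y, maxError N q) := by
  have hk1 : (1 : ℝ) ≤ k := by exact_mod_cast hk
  refine (sum_abs_gpyWeight_mul_le hP hk hPk ht
    (fun U => ((k : ℝ) - 1) ^ U.card * maxError N (W * ∏ p ∈ U, p))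
    fun U => mul_nonneg (pow_nonneg (by linarith) _) (maxError_nonneg _ _)).trans ?_
  gcongr
  have hW1 : (1 : ℝ) ≤ W := by exact_mod_cast hW
  have hqY : ∀ U ∈ smallSubsets P (2 * t), W * ∏ p ∈ U, p ≤ Y := by
    intro U hU
    have h1 := (prod_le_floor_exp hP hU).le
    have h2 : ((W * ∏ p ∈ U, p : ℕ) : ℝ) ≤ Y := by
      rw [Nat.cast_mul]
      exact (mul_le_mul_of_nonneg_left h1 (by linarith)).trans hY
    exact_mod_cast h2
  have hY1 : 1 ≤ Y := by
    have h1 := Real.one_le_exp (by linarith : 0 ≤ 2 * t)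
    have h2 : (1 : ℝ) ≤ Y := by nlinarith
    exact_mod_cast h2
  have hN1 : (1 : ℝ) ≤ N := by exact_mod_cast hY1.trans hYN
  have hlog : 0 ≤ Real.log (2 * N) := Real.log_nonneg (by linarith)
  have htriv : ∀ U ∈ smallSubsets P (2 * t), maxError N (W * ∏ p ∈ U, p) ≤
      (3 * Real.log (2 * N) + 1) * N * ∏ p ∈ U, (2 : ℝ) / p := by
    intro U hU
    have hUP := (mem_smallSubsets.1 hU).1
    have hUp : ∀ p ∈ U, p.Prime := fun p hp => hP p (hUP hp)
    have hd : 0 < ∏ p ∈ U, p := prod_pos_of_prime hUp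
    refine (maxError_le (Nat.mul_pos hW hd) ((hqY U hU).trans hYN)).trans ?_
    have hphiW : (1 : ℝ) ≤ W.totient := by exact_mod_cast Nat.totient_pos.2 hW
    have h2 : ∏ p ∈ U, (p : ℝ)⁻¹ ≤ ∏ p ∈ U, (2 : ℝ) / p := by
      refine prod_le_prod (fun p _ => by positivity) fun p _ => ?_
      rw [div_eq_mul_inv]
      exact le_mul_of_one_le_left (by positivity) one_le_two
    have h3 : ∏ p ∈ U, ((p : ℝ) - 1)⁻¹ ≤ ∏ p ∈ U, (2 : ℝ) / p := by
      refine prod_le_prod (fun p hp => ?_) fun p hp => ?_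
      · have : (1 : ℝ) ≤ p := by exact_mod_cast (hUp p hp).one_le
        exact inv_nonneg.2 (by linarith)
      · have h4 : (2 : ℝ) ≤ p := by exact_mod_cast (hUp p hp).two_le
        rw [inv_eq_one_div, div_le_div_iff₀ (by linarith) (by linarith)]
        linarith
    have hQ0 : 0 ≤ ∏ p ∈ U, (2 : ℝ) / p := prod_nonneg fun p _ => by positivity
    have h4 : 1 / ((W * ∏ p ∈ U, p : ℕ) : ℝ) ≤ ∏ p ∈ U, (2 : ℝ) / p := by
      refine le_trans ?_ h2
      rw [prod_inv_distrib, ← one_div]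
      push_cast
      have : (0 : ℝ) < ∏ p ∈ U, (p : ℝ) :=
        prod_pos fun p hp => by exact_mod_cast (hUp p hp).pos
      apply one_div_le_one_div_of_le this
      exact le_mul_of_one_le_left this.le hW1
    have h5 : 1 / ((W * ∏ p ∈ U, p).totient : ℝ) ≤ ∏ p ∈ U, (2 : ℝ) / p := by
      refine le_trans ?_ h3
      rw [prod_inv_distrib, ← one_div, totient_mul_prod_primes hUp fun p hp => hPW p (hUP hp)]
      have : (0 : ℝ) < ∏ p ∈ U, ((p : ℝ) - 1) := prod_pos fun p hp => by
        have : (1 : ℝ) < p := by exact_mod_cast (hUp p hp).one_lt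
        linarith
      apply one_div_le_one_div_of_le this
      exact le_mul_of_one_le_left this.le hphiW
    calc _ = 3 * N * Real.log (2 * N) * (1 / ((W * ∏ p ∈ U, p : ℕ) : ℝ)) +
          N * (1 / ((W * ∏ p ∈ U, p).totient : ℝ)) := by ring
      _ ≤ 3 * N * Real.log (2 * N) * (∏ p ∈ U, (2 : ℝ) / p) + N * ∏ p ∈ U, (2 : ℝ) / p := by
          gcongr
      _ = _ := by ring
  have hsplit : ∀ U ∈ smallSubsets P (2 * t),
      16 ^ U.card * (((k : ℝ) - 1) ^ U.card * maxError N (W * ∏ p ∈ U, p)) ≤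
      (3 * Real.log (2 * N) + 1) * N / M * ∏ p ∈ U, ((512 * k ^ 2 : ℕ) : ℝ) / p +
        M * maxError N (W * ∏ p ∈ U, p) := by
    intro U hU
    set e := maxError N (W * ∏ p ∈ U, p) with he
    have he0 : 0 ≤ e := maxError_nonneg _ _
    set c : ℝ := (16 * k) ^ U.card with hc
    have hc1 : c ≤ c ^ 2 / M + M := by
      rw [div_add' _ _ _ hM.ne', le_div_iff₀ hM]
      nlinarith [sq_nonneg (c - M), sq_nonneg c, sq_nonneg M]
    have h1 : (16 : ℝ) ^ U.card * (((k : ℝ) - 1) ^ U.card * e) ≤ c * e := by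
      rw [← mul_assoc, ← mul_pow, hc]
      gcongr
      linarith
    have h2 : c ^ 2 * ∏ p ∈ U, (2 : ℝ) / p = ∏ p ∈ U, ((512 * k ^ 2 : ℕ) : ℝ) / p := by
      rw [hc, ← pow_mul, mul_comm U.card 2, pow_mul, ← prod_const, ← prod_mul_distrib]
      refine prod_congr rfl fun p _ => ?_
      push_cast
      ring
    calc _ ≤ c * e := h1
      _ ≤ (c ^ 2 / M + M) * e := by gcongr
      _ = c ^ 2 / M * e + M * e := by ring
      _ ≤ c ^ 2 / M * ((3 * Real.log (2 * N) + 1) * N * ∏ p ∈ U, (2 : ℝ) / p) + M * e := by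
          gcongr
          exact htriv U hU
      _ = (3 * Real.log (2 * N) + 1) * N / M * (c ^ 2 * ∏ p ∈ U, (2 : ℝ) / p) + M * e := by ring
      _ = _ := by rw [h2]
  refine (sum_le_sum hsplit).trans ?_
  rw [sum_add_distrib, ← mul_sum, ← mul_sum]
  refine add_le_add ?_ ?_
  · calc _ ≤ (3 * Real.log (2 * N) + 1) * N / M * (1 + 2 * t) ^ (512 * k ^ 2) := by
          refine mul_le_mul_of_nonneg_left ?_ (by positivity)
          exact sum_smallSubsets_prod_div_le hP (by linarith) _
      _ = _ := by ring
  · refine mul_le_mul_of_nonneg_left ?_ hM.le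
    have hinj : Set.InjOn (fun U : Finset ℕ => W * ∏ p ∈ U, p) (smallSubsets P (2 * t)) := by
      intro S hS T hT h
      refine injOn_prod_primes hP (mem_smallSubsets.1 hS).1 (mem_smallSubsets.1 hT).1 ?_
      exact Nat.eq_of_mul_eq_mul_left hW h
    rw [← sum_image (f := fun q => maxError N q) hinj]
    refine sum_le_sum_of_subset_of_nonneg (fun q hq => ?_) fun q _ _ => maxError_nonneg _ _
    obtain ⟨U, hU, rfl⟩ := mem_image.1 hq
    rw [mem_Icc]
    exact ⟨Nat.mul_pos hW (prod_pos_of_prime fun p hp => hP p ((mem_smallSubsets.1 hU).1 hp)),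
      hqY U hU⟩

/-! ### Asymptotics of the error terms and the choice of the residue class -/

open Filter Topology

theorem tendsto_log_natCast : Tendsto (fun N : ℕ => Real.log N) atTop atTop :=
  Real.tendsto_log_atTop.comp tendsto_natCast_atTop_atTop

theorem weightBound_le {t u : ℝ} (ht : 0 ≤ t) (htu : t ≤ u) (hu : 1 ≤ u) (k : ℕ) :
    (t * (1 + t) ^ (2 * k)) ^ 2 ≤ (3 * u) ^ (4 * k + 2) := by
  calc (t * (1 + t) ^ (2 * k)) ^ 2 ≤ ((3 * u) * (3 * u) ^ (2 * k)) ^ 2 := by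
        gcongr
        · linarith
        · linarith
    _ = _ := by ring

/-- With `exp (2 t) = N ^ θ` the error in the sum over integers saves a power of `N`. -/
theorem eventually_error_integers_le {θ : ℝ} (hθ0 : 0 < θ) (hθ1 : θ < 1) (k : ℕ) :
    ∀ᶠ N : ℕ in atTop, Real.log (2 * N) * ((θ / 2 * Real.log N *
      (1 + θ / 2 * Real.log N) ^ (2 * k)) ^ 2 * (Real.exp (2 * (θ / 2 * Real.log N)) *
        (1 + 2 * (θ / 2 * Real.log N)) ^ (16 * k))) ≤ N := by
  set m := 1 + (4 * k + 2) + 16 * k with hm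
  have h1 : ∀ᶠ u : ℝ in atTop, (3 : ℝ) ^ m * u ^ m ≤ Real.exp ((1 - θ) * u) := by
    have h2 := (isLittleO_pow_exp_pos_mul_atTop m (by linarith : 0 < 1 - θ)).bound
      (by positivity : (0 : ℝ) < (3 ^ m)⁻¹)
    filter_upwards [h2, eventually_ge_atTop 0] with u hu hu0
    rw [Real.norm_of_nonneg (by positivity), Real.norm_of_nonneg (Real.exp_pos _).le,
      le_inv_mul_iff₀ (by positivity)] at hu
    exact hu
  filter_upwards [tendsto_log_natCast.eventually h1,
    tendsto_log_natCast.eventually_ge_atTop 1, eventually_ge_atTop 1] with N hN hu hN1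
  set u := Real.log N with hu_def
  have hN0 : (0 : ℝ) < N := by exact_mod_cast hN1
  have hexp : Real.exp u = N := Real.exp_log hN0
  have ht0 : 0 ≤ θ / 2 * u := by positivity
  have htu : θ / 2 * u ≤ u := by nlinarith
  have htu2 : 2 * (θ / 2 * u) ≤ u := by nlinarith
  have hlog2 : Real.log (2 * N) ≤ 3 * u := by
    rw [Real.log_mul two_ne_zero hN0.ne']
    linarith [Real.log_two_lt_d9]
  have hlog0 : 0 ≤ Real.log (2 * N) := by
    rw [Real.log_mul two_ne_zero hN0.ne']
    linarith [Real.log_two_gt_d9]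
  calc _ ≤ (3 * u) * ((3 * u) ^ (4 * k + 2) * (Real.exp (2 * (θ / 2 * u)) *
        (3 * u) ^ (16 * k))) := by
        gcongr
        · exact weightBound_le ht0 htu hu k
        · linarith
    _ = (3 ^ m * u ^ m) * Real.exp (2 * (θ / 2 * u)) := by
        rw [← mul_pow, hm]; ring
    _ ≤ Real.exp ((1 - θ) * u) * Real.exp (2 * (θ / 2 * u)) := by gcongr
    _ = N := by rw [← Real.exp_add, ← hexp]; congr 1; ring

/-- The error in the sums over primes is at most `N`: the parameter `M` is a power of `3 log N` that
absorbs all logarithms multiplying the trivial bound, and the level of distribution is used with an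
exponent `A` that absorbs `M` as well. -/
theorem eventually_error_primes_le {θ θ' : ℝ} (hθ0 : 0 < θ') (hθ1 : θ' < 1)
    (hlevel : LevelOfDistribution θ) (k : ℕ) :
    ∀ᶠ N : ℕ in atTop, ∃ M : ℝ, 0 < M ∧ (θ' / 2 * Real.log N *
      (1 + θ' / 2 * Real.log N) ^ (2 * k)) ^ 2 *
        ((3 * Real.log (2 * N) + 1) * N * (1 + 2 * (θ' / 2 * Real.log N)) ^ (512 * k ^ 2) / M +
          M * ∑ q ∈ Icc 1 ⌊(N : ℝ) ^ θ⌋₊, maxError N q) ≤ N := by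
  set m := 512 * k ^ 2 + (4 * k + 4) with hm
  set A := (4 * k + 2) + (m + 1) + 1 with hA
  obtain ⟨c, hc⟩ := (hlevel (A : ℝ) (by positivity)).bound
  have hc' := (tendsto_natCast_atTop_atTop (R := ℝ)).eventually hc
  filter_upwards [hc', tendsto_log_natCast.eventually_ge_atTop 1, eventually_ge_atTop 1,
    tendsto_log_natCast.eventually_ge_atTop (2 * (3 ^ A * c))] with N hN hu hN1 hcu
  set u := Real.log N with hu_def
  have hu0 : 0 < u := by linarith
  have hN0 : (0 : ℝ) < N := by exact_mod_cast hN1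
  have ht0 : 0 ≤ θ' / 2 * u := by positivity
  have htu : θ' / 2 * u ≤ u := by nlinarith
  have htu2 : 2 * (θ' / 2 * u) ≤ u := by nlinarith
  have hlog2 : Real.log (2 * N) ≤ 2 * u := by
    rw [Real.log_mul two_ne_zero hN0.ne']
    linarith [Real.log_two_lt_d9]
  have hlog0 : 0 ≤ Real.log (2 * N) := by
    rw [Real.log_mul two_ne_zero hN0.ne']
    linarith [Real.log_two_gt_d9]
  have hsum0 : 0 ≤ ∑ q ∈ Icc 1 ⌊(N : ℝ) ^ θ⌋₊, maxError N q :=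
    sum_nonneg fun q _ => maxError_nonneg _ _
  rw [Real.norm_of_nonneg hsum0, Real.rpow_natCast, Real.norm_of_nonneg (by positivity)] at hN
  refine ⟨(3 * u) ^ (m + 1), by positivity, ?_⟩
  rw [mul_add]
  have h1 : (θ' / 2 * u * (1 + θ' / 2 * u) ^ (2 * k)) ^ 2 * ((3 * Real.log (2 * N) + 1) * N *
      (1 + 2 * (θ' / 2 * u)) ^ (512 * k ^ 2) / (3 * u) ^ (m + 1)) ≤ N / 2 := by
    calc _ ≤ (3 * u) ^ (4 * k + 2) * ((3 * u) ^ 2 * N *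
          (3 * u) ^ (512 * k ^ 2) / (3 * u) ^ (m + 1)) := by
          gcongr
          · exact weightBound_le ht0 htu hu k
          · nlinarith
          · linarith
      _ = N / (3 * u) := by
          rw [hm]
          field_simp
          ring
      _ ≤ N / 2 := by
          gcongr
          linarith
  have h2 : (θ' / 2 * u * (1 + θ' / 2 * u) ^ (2 * k)) ^ 2 * ((3 * u) ^ (m + 1) *
      ∑ q ∈ Icc 1 ⌊(N : ℝ) ^ θ⌋₊, maxError N q) ≤ N / 2 := by
    calc _ ≤ (3 * u) ^ (4 * k + 2) * ((3 * u) ^ (m + 1) * (c * (N / u ^ A))) := by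
          gcongr
          exact weightBound_le ht0 htu hu k
      _ = N * (3 ^ (4 * k + 2 + (m + 1)) * c / u) := by
          rw [hA, pow_succ u, pow_add u (4 * k + 2), mul_pow, mul_pow, pow_add (3 : ℝ) (4 * k + 2)]
          field_simp
      _ ≤ N * (1 / 2) := by
          refine mul_le_mul_of_nonneg_left ?_ hN0.le
          rw [div_le_div_iff₀ hu0 two_pos, one_mul]
          have hc0 : 0 ≤ c := by
            by_contra h
            have : c * (N / u ^ A) < 0 := mul_neg_of_neg_of_pos (by linarith) (by positivity)
            linarith
          have : (3 : ℝ) ^ (4 * k + 2 + (m + 1)) ≤ 3 ^ A :=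
            pow_le_pow_right₀ (by norm_num) (by omega)
          nlinarith [mul_le_mul_of_nonneg_right this hc0]
      _ = _ := by ring
  linarith

/-- The primes up to `D`. -/
def smallPrimes (D : ℕ) : Finset ℕ := {p ∈ Icc 1 D | p.Prime}

/-- The primes in `(D, exp t]`. -/
noncomputable def largePrimes (D : ℕ) (t : ℝ) : Finset ℕ := {p ∈ Ioc D ⌊Real.exp t⌋₊ | p.Prime}

theorem prime_of_mem_smallPrimes {D p : ℕ} (h : p ∈ smallPrimes D) : p.Prime :=
  (mem_filter.1 h).2

theorem prime_of_mem_largePrimes {D p : ℕ} {t : ℝ} (h : p ∈ largePrimes D t) : p.Prime :=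
  (mem_filter.1 h).2

theorem lt_of_mem_largePrimes {D p : ℕ} {t : ℝ} (h : p ∈ largePrimes D t) : D < p :=
  (mem_Ioc.1 (mem_filter.1 h).1).1

theorem disjoint_largePrimes_smallPrimes (D : ℕ) (t : ℝ) :
    Disjoint (largePrimes D t) (smallPrimes D) := by
  rw [disjoint_left]
  intro p hp hq
  have h1 := lt_of_mem_largePrimes hp
  have h2 := (mem_Icc.1 (mem_filter.1 hq).1).2
  omega

theorem mem_largePrimes_union_smallPrimes {D p : ℕ} {t : ℝ} (hp : p.Prime)
    (hpt : Real.log p ≤ t) : p ∈ largePrimes D t ∪ smallPrimes D := by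
  rw [mem_union, largePrimes, smallPrimes, mem_filter, mem_filter, mem_Ioc, mem_Icc]
  have h1 : p ≤ ⌊Real.exp t⌋₊ :=
    Nat.le_floor ((Real.log_le_iff_le_exp (by exact_mod_cast hp.pos)).1 hpt)
  rcases lt_or_ge D p with h | h
  · exact Or.inl ⟨⟨h, h1⟩, hp⟩
  · exact Or.inr ⟨⟨hp.one_le, h⟩, hp⟩

theorem not_dvd_prod_smallPrimes {D p : ℕ} {t : ℝ} (hp : p ∈ largePrimes D t) :
    ¬p ∣ ∏ q ∈ smallPrimes D, q := by
  intro h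
  have hpp := prime_of_mem_largePrimes hp
  obtain ⟨q, hq, hd⟩ := (hpp.prime.dvd_finsetProd_iff _).1 h
  rw [Nat.prime_dvd_prime_iff_eq hpp (prime_of_mem_smallPrimes hq)] at hd
  subst hd
  exact disjoint_left.1 (disjoint_largePrimes_smallPrimes D t) hp hq

theorem totient_prod_smallPrimes_div (D : ℕ) :
    ((∏ q ∈ smallPrimes D, q).totient : ℝ) / (∏ q ∈ smallPrimes D, q : ℕ) =
      ∏ q ∈ smallPrimes D, (1 - (q : ℝ)⁻¹) := by
  rw [totient_prod_primes fun p hp => prime_of_mem_smallPrimes hp]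
  push_cast
  rw [← prod_div_distrib]
  refine prod_congr rfl fun q hq => ?_
  have : (q : ℝ) ≠ 0 := by exact_mod_cast (prime_of_mem_smallPrimes hq).ne_zero
  rw [sub_div, div_self this, one_div]

/-- Beyond a large `D` the convergent Euler products are close to `1`. -/
theorem eventually_prod_largePrimes_le (k : ℕ) {ε : ℝ} (hε : 0 < ε) :
    ∀ᶠ D : ℕ in atTop, ∀ t : ℝ,
      ∏ p ∈ largePrimes D t, (1 + (k : ℝ) / (p * (p - k))) ≤ 1 + ε := by
  have h1 : Tendsto (fun D : ℕ => Real.exp (2 * k * (2 / ((D : ℝ) + 1)))) atTop (𝓝 1) := by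
    have h2 : Tendsto (fun D : ℕ => 2 * (k : ℝ) * (2 / ((D : ℝ) + 1))) atTop (𝓝 0) := by
      have h3 : Tendsto (fun D : ℕ => (2 : ℝ) / ((D : ℝ) + 1)) atTop (𝓝 0) := by
        have := (tendsto_one_div_add_atTop_nhds_zero_nat (𝕜 := ℝ)).const_mul 2
        simpa [div_eq_mul_inv] using this
      simpa using h3.const_mul (2 * (k : ℝ))
    simpa [Function.comp_def] using (Real.continuous_exp.tendsto 0).comp h2
  filter_upwards [h1.eventually_lt_const (by linarith : 1 < 1 + ε), eventually_ge_atTop (2 * k)]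
    with D hD hDk t
  refine le_trans ?_ hD.le
  calc _ ≤ ∏ p ∈ largePrimes D t, Real.exp (2 * k * ((p : ℝ) ^ 2)⁻¹) := by
        have hbound : ∀ p ∈ largePrimes D t, 0 < (p : ℝ) - k ∧ (0 : ℝ) < p ∧ 2 * (k : ℝ) ≤ p := by
          intro p hp
          have h2 : 2 * k < p := hDk.trans_lt (lt_of_mem_largePrimes hp)
          have h3 : 2 * (k : ℝ) < p := by exact_mod_cast h2
          have h4 : (0 : ℝ) ≤ k := Nat.cast_nonneg k
          refine ⟨by linarith, by linarith, h3.le⟩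
        refine prod_le_prod (fun p hp => ?_) fun p hp => ?_
        · obtain ⟨h2, h3, -⟩ := hbound p hp
          positivity
        · obtain ⟨h2, h3, h4⟩ := hbound p hp
          refine le_trans ?_ (Real.add_one_le_exp _)
          rw [add_comm]
          gcongr
          rw [← div_eq_mul_inv, div_le_div_iff₀ (by positivity) (by positivity)]
          have h5 : (0 : ℝ) ≤ k * p * (p - 2 * k) :=
            mul_nonneg (by positivity) (by linarith)
          nlinarith
    _ = Real.exp (2 * k * ∑ p ∈ largePrimes D t, ((p : ℝ) ^ 2)⁻¹) := by
        rw [mul_sum, Real.exp_sum]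
    _ ≤ _ := by
        gcongr
        refine le_trans ?_ (sum_Ioo_inv_sq_le (α := ℝ) D (⌊Real.exp t⌋₊ + 1))
        refine sum_le_sum_of_subset_of_nonneg (fun p hp => ?_) fun p _ _ => by positivity
        have := mem_Ioc.1 (mem_filter.1 hp).1
        rw [mem_Ioo]
        omega

/-- For an admissible set there is a residue class modulo any squarefree number in which all the
shifts are coprime to the modulus. -/
theorem Admissible.exists_coprime {H : Finset ℤ} (hH : Admissible H) (Q : Finset ℕ)
    (hQ : ∀ p ∈ Q, p.Prime) :
    ∃ a : ℤ, ∀ h ∈ H, IsCoprime (a + h) ((∏ p ∈ Q, p : ℕ) : ℤ) := by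
  have hloc : ∀ p : ℕ, p.Prime → ∃ v : ℤ, ∀ h ∈ H, ¬((p : ℤ) ∣ v + h) := by
    intro p hp
    have : Fact p.Prime := ⟨hp⟩
    obtain ⟨v, hv⟩ : ∃ v : ZMod p, v ∉ Omega H p := by
      by_contra! hall
      have h1 : Omega H p = univ := eq_univ_iff_forall.2 hall
      have h2 := hH p hp
      rw [h1, card_univ, ZMod.card] at h2
      exact lt_irrefl _ h2
    refine ⟨(v.val : ℤ), fun h hh hd => hv ?_⟩
    rw [Omega, mem_image]
    refine ⟨h, hh, ?_⟩
    have h1 := (ZMod.intCast_zmod_eq_zero_iff_dvd _ p).2 hd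
    push_cast at h1
    rw [ZMod.natCast_zmod_val] at h1
    push_cast
    exact (eq_neg_of_add_eq_zero_left h1).symm
  have key : ∀ Q : Finset ℕ, (∀ p ∈ Q, p.Prime) →
      ∃ a : ℤ, ∀ p ∈ Q, ∀ h ∈ H, ¬((p : ℤ) ∣ a + h) := by
    intro Q
    induction Q using Finset.induction_on with
    | empty => exact fun _ => ⟨0, by simp⟩
    | insert p Q hpQ ih =>
      intro hQ
      obtain ⟨a, ha⟩ := ih fun q hq => hQ q (mem_insert_of_mem hq)
      have hp := hQ p (mem_insert_self p Q)
      obtain ⟨v, hv⟩ := hloc p hp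
      have hnd : ¬p ∣ ∏ q ∈ Q, q := by
        intro hd
        obtain ⟨q, hq, hd⟩ := (hp.prime.dvd_finsetProd_iff _).1 hd
        rw [Nat.prime_dvd_prime_iff_eq hp (hQ q (mem_insert_of_mem hq))] at hd
        exact hpQ (hd ▸ hq)
      obtain ⟨c, hc⟩ := exists_crt hp hnd a v
      obtain ⟨hc1, hc2⟩ := (hc c).1 (Int.ModEq.refl _)
      refine ⟨c, fun q hq h hh hd => ?_⟩
      rcases mem_insert.1 hq with rfl | hq
      · exact hv h hh ((hc2.add_right h).dvd_iff.1 hd)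
      · have hqd : (q : ℤ) ∣ ((∏ q ∈ Q, q : ℕ) : ℤ) :=
          Int.natCast_dvd_natCast.2 (dvd_prod_of_mem _ hq)
        exact ha q hq h hh (((hc1.of_dvd hqd).add_right h).dvd_iff.1 hd)
  obtain ⟨a, ha⟩ := key Q hQ
  refine ⟨a, fun h hh => ?_⟩
  push_cast
  refine IsCoprime.prod_right fun p hp => ?_
  exact ((Nat.prime_iff_prime_int.1 (hQ p hp)).irreducible.coprime_iff_not_dvd.2
    (ha p hp h hh)).symm

/-- If at most one of the numbers `n + h` is prime, the prime weights at `n` add up to at most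
`log (2 N)`. -/
theorem sum_primeWeight_le {H : Finset ℤ} {N n : ℕ} (hN : 0 < N)
    (hn : primeCount H n ≤ 1) : ∑ h ∈ H, primeWeight N h n ≤ Real.log (2 * N) := by
  have hN1 : (1 : ℝ) ≤ N := by exact_mod_cast hN
  have hlog : 0 ≤ Real.log (2 * N) := Real.log_nonneg (by linarith)
  have h1 : ∑ h ∈ H, primeWeight N h n ≤
      ∑ h ∈ H with ((n : ℤ) + h).toNat.Prime, Real.log (2 * N) := by
    rw [sum_filter]
    refine sum_le_sum fun h _ => ?_
    unfold primeWeight varpi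
    split_ifs with h1 h2 h2
    · refine Real.log_le_log (by exact_mod_cast h2.pos) ?_
      have : ((n : ℤ) + h).toNat ≤ 2 * N := by omega
      exact_mod_cast this
    · exact le_rfl
    · exact hlog
    · exact le_rfl
  refine h1.trans ?_
  rw [sum_const, nsmul_eq_mul]
  refine mul_le_of_le_one_left hlog ?_
  unfold primeCount at hn
  exact_mod_cast hn

/-! ### Two primes infinitely often -/

/-- The comparison of the two sums of squares when no `n` in the interval gives two primes. -/
theorem sieve_inequality {H : Finset ℤ} (hk : 2 ≤ H.card) {D C N : ℕ} (hDk : 2 * H.card ≤ D)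
    (hC : ∀ h ∈ H, |h| ≤ C) (hDC : 2 * C ≤ D) (hCN : C ≤ N) (hN : 0 < N) {ε t M θ : ℝ}
    (hε : ∀ t : ℝ, ∏ p ∈ largePrimes D t, (1 + (H.card : ℝ) / (p * (p - H.card))) ≤ 1 + ε)
    (ht : 0 ≤ t) (htN : Real.exp t ≤ N) (hadm : Admissible H) (hM : 0 < M) (hθ1 : θ ≤ 1)
    (hlevel : (∏ q ∈ smallPrimes D, q : ℕ) * Real.exp (2 * t) ≤ ⌊(N : ℝ) ^ θ⌋₊)
    (herr1 : Real.log (2 * N) * ((t * (1 + t) ^ (2 * H.card)) ^ 2 *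
      (Real.exp (2 * t) * (1 + 2 * t) ^ (16 * H.card))) ≤ N)
    (herr2 : (t * (1 + t) ^ (2 * H.card)) ^ 2 *
      ((3 * Real.log (2 * N) + 1) * N * (1 + 2 * t) ^ (512 * H.card ^ 2) / M +
          M * ∑ q ∈ Icc 1 ⌊(N : ℝ) ^ θ⌋₊, maxError N q) ≤ N)
    (hno : ∀ n ∈ Ioc (N - C) (2 * N + C), primeCount H n ≤ 1) :
    (H.card : ℝ) / 4 * sieveMoment (largePrimes D t) H.card t 4 ≤
      Real.log (2 * N) * (1 + 2 * C / N) * (1 + ε) *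
        (sieveMoment (largePrimes D t) H.card t 3 / 3 +
          2 * (∏ q ∈ smallPrimes D, q : ℕ) * sieveMoment (largePrimes D t) H.card t 2) +
      (H.card + 1) * ((∏ q ∈ smallPrimes D, q : ℕ) /
        ∏ q ∈ smallPrimes D, (1 - (q : ℝ)⁻¹)) := by
  set k := H.card with hkdef
  set P := largePrimes D t with hPdef
  set Q := smallPrimes D with hQdef
  set W := ∏ q ∈ Q, q with hWdef
  set ω := ∏ q ∈ Q, (1 - (q : ℝ)⁻¹) with hω
  have hQp : ∀ p ∈ Q, p.Prime := fun p hp => prime_of_mem_smallPrimes hp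
  have hPp : ∀ p ∈ P, p.Prime := fun p hp => prime_of_mem_largePrimes hp
  have hW : 0 < W := prod_pos_of_prime hQp
  have hW0 : (0 : ℝ) < W := by exact_mod_cast hW
  have hN0 : (0 : ℝ) < N := by exact_mod_cast hN
  have hN1 : (1 : ℝ) ≤ N := by exact_mod_cast hN
  have hω0 : 0 < ω := prod_pos fun p hp => one_sub_inv_pos_of_prime (hQp p hp)
  have hφ : (W.totient : ℝ) = ω * W := by
    rw [hω, hQdef, ← totient_prod_smallPrimes_div D, div_mul_cancel₀ _ hW0.ne']
  have hPW : ∀ p ∈ P, ¬p ∣ W := fun p hp => not_dvd_prod_smallPrimes hp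
  have hPW' : ∀ p ∈ P, W.Coprime p := fun p hp =>
    ((Nat.Prime.coprime_iff_not_dvd (hPp p hp)).2 (hPW p hp)).symm
  have hk1 : (2 : ℝ) ≤ k := by exact_mod_cast hk
  have hPk2 : ∀ p ∈ P, 2 * (k : ℝ) ≤ p := fun p hp => by
    exact_mod_cast hDk.trans (lt_of_mem_largePrimes hp).le
  have hPk : ∀ p ∈ P, (k : ℝ) < p := fun p hp => by linarith [hPk2 p hp]
  have hPN : ∀ p ∈ P, p ≤ N := by
    intro p hp
    have h1 := (mem_Ioc.1 (mem_filter.1 hp).1).2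
    have h2 : ((⌊Real.exp t⌋₊ : ℕ) : ℝ) ≤ N := (Nat.floor_le (Real.exp_pos t).le).trans htN
    exact h1.trans (by exact_mod_cast h2)
  have hHP : ∀ p ∈ P, ∀ h ∈ H, ∀ h' ∈ H, (p : ℤ) ∣ h - h' → h = h' := by
    intro p hp h hh h' hh' hd
    have h1 := abs_le.1 (hC h hh)
    have h2 := abs_le.1 (hC h' hh')
    have h3 := lt_of_mem_largePrimes hp
    have h4 : h - h' = 0 := by
      refine Int.eq_zero_of_abs_lt_dvd hd ?_
      rw [abs_lt]
      constructor <;> omega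
    omega
  obtain ⟨a, ha⟩ := hadm.exists_coprime Q hQp
  set I := Ioc (N - C) (2 * N + C) with hI
  have hAB : N - C ≤ 2 * N + C := by omega
  have hlog0 : 0 ≤ Real.log (2 * N) := Real.log_nonneg (by linarith)
  set m2 := sieveMoment P k t 2
  set m3 := sieveMoment P k t 3
  set m4 := sieveMoment P k t 4
  have hm2 : 0 ≤ m2 := sieveMoment_nonneg (by linarith) hPk t 2
  have hm3 : 0 ≤ m3 := sieveMoment_nonneg (by linarith) hPk t 3
  set S₁ := ∑ n ∈ I with ((n : ℕ) : ℤ) ≡ a [ZMOD W], sieveSum P H (gpyWeight P k t) n ^ 2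
  -- the sum over integers, from above
  have hS1 : Real.log (2 * N) * S₁ ≤ Real.log (2 * N) * (((N : ℝ) + 2 * C) / W *
      ((1 + ε) * (ω * (m3 / 3) + 2 * (ω * W) * m2))) + N := by
    have h1 := abs_sum_sieveSum_sq_sub_le P hPp H hHP W hW hPW (gpyWeight P k t) hAB a
    have h2 := (abs_le.1 (h1.trans (error_integers_le hPp (by omega) hPk2 ht))).2
    rw [quadForm_integers P k (by linarith) hPk t] at h2
    have h3 := sum_prod_mul_ell_sq_le_sieveMoment P hPp W hW hPW' k (by linarith) hPk t
    have h4 : ((2 * N + C : ℕ) : ℝ) - ((N - C : ℕ) : ℝ) = N + 2 * C := by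
      rw [Nat.cast_sub hCN]; push_cast; ring
    rw [h4] at h2
    have h5 : ∑ T ∈ P.powerset, (∏ p ∈ T, (k : ℝ) / (p - k)) * ell t T ^ 2 ≤
        (1 + ε) * (ω * (m3 / 3) + 2 * (ω * W) * m2) := by
      refine h3.trans ?_
      rw [hφ, mul_div_assoc, div_self hW0.ne', mul_one]
      refine mul_le_mul_of_nonneg_right (hε t) ?_
      positivity
    have h6 : ((N : ℝ) + 2 * C) / W *
        ∑ T ∈ P.powerset, (∏ p ∈ T, (k : ℝ) / (p - k)) * ell t T ^ 2 ≤
        ((N : ℝ) + 2 * C) / W * ((1 + ε) * (ω * (m3 / 3) + 2 * (ω * W) * m2)) := by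
      gcongr
    have h7 : S₁ ≤ ((N : ℝ) + 2 * C) / W * ((1 + ε) * (ω * (m3 / 3) + 2 * (ω * W) * m2)) +
        (t * (1 + t) ^ (2 * k)) ^ 2 * (Real.exp (2 * t) * (1 + 2 * t) ^ (16 * k)) := by
      linarith
    calc _ ≤ Real.log (2 * N) * (_ + _) := mul_le_mul_of_nonneg_left h7 hlog0
      _ ≤ _ := by rw [mul_add]; linarith
  -- the sums over primes, from below
  have hS2 : ∀ h ∈ H, (N : ℝ) / W * (ω / 4 * m4) - N ≤
      ∑ n ∈ I with ((n : ℕ) : ℤ) ≡ a [ZMOD W],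
        primeWeight N h n * sieveSum P H (gpyWeight P k t) n ^ 2 := by
    intro h hh
    have hCh := abs_le.1 (hC h hh)
    have h1 := abs_sum_primeWeight_mul_sieveSum_sq_sub_le P hPp H hHP W hW hPW
      (gpyWeight P k t) (N := N) (A := N - C) (B := 2 * N + C) hh (by omega)
      (by push_cast; omega) (by omega) hPN a (ha h hh)
    have hYN : ⌊(N : ℝ) ^ θ⌋₊ ≤ N := by
      have : (N : ℝ) ^ θ ≤ N := by
        simpa using Real.rpow_le_rpow_of_exponent_le hN1 hθ1
      exact Nat.floor_le_of_le this
    have h2 := (abs_le.1 (h1.trans ((error_primes_le hPp (by omega) hPk2 ht hW hPW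
      hlevel hYN hM).trans herr2))).1
    have h3 : ω ^ 2 / 4 * m4 ≤ _ := sieveMoment_four_le_quadForm_primes P Q hPp hQp
      (disjoint_largePrimes_smallPrimes D t) k (by linarith) hPk t
      fun p hp hpt => mem_largePrimes_union_smallPrimes hp hpt
    have h4 : (N : ℝ) / W * (ω / 4 * m4) ≤ (N : ℝ) / W.totient *
        ∑ S ∈ P.powerset, ∑ T ∈ P.powerset, gpyWeight P k t S * gpyWeight P k t T *
          ∏ p ∈ S ∪ T, ((k : ℝ) - 1) / ((p : ℝ) - 1) := by
      refine le_trans (le_of_eq ?_) (mul_le_mul_of_nonneg_left h3 (by positivity))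
      rw [hφ]
      field_simp
    linarith
  have hcomp : ∑ h ∈ H, ∑ n ∈ I with ((n : ℕ) : ℤ) ≡ a [ZMOD W],
      primeWeight N h n * sieveSum P H (gpyWeight P k t) n ^ 2 ≤ Real.log (2 * N) * S₁ := by
    rw [sum_comm, mul_sum]
    refine sum_le_sum fun n hn => ?_
    rw [← sum_mul]
    exact mul_le_mul_of_nonneg_right (sum_primeWeight_le hN (hno n (mem_filter.1 hn).1))
      (sq_nonneg _)
  have hfin : (k : ℝ) * ((N : ℝ) / W * (ω / 4 * m4) - N) ≤
      Real.log (2 * N) * (((N : ℝ) + 2 * C) / W *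
      ((1 + ε) * (ω * (m3 / 3) + 2 * (ω * W) * m2))) + N := by
    refine le_trans ?_ hS1
    refine le_trans ?_ hcomp
    refine le_trans (le_of_eq ?_) (sum_le_sum hS2)
    rw [sum_const, nsmul_eq_mul]
  -- divide by the common size `N * ω / W` of the two main terms
  have hscale : 0 < (W : ℝ) / (N * ω) := by positivity
  have h1 := mul_le_mul_of_nonneg_left hfin hscale.le
  have h2 : (W : ℝ) / (N * ω) * ((k : ℝ) * ((N : ℝ) / W * (ω / 4 * m4) - N)) =
      k / 4 * m4 - k * (W / ω) := by
    field_simp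
  have h3 : (W : ℝ) / (N * ω) * (Real.log (2 * N) * (((N : ℝ) + 2 * C) / W *
      ((1 + ε) * (ω * (m3 / 3) + 2 * (ω * W) * m2))) + N) =
      Real.log (2 * N) * (1 + 2 * C / N) * (1 + ε) * (m3 / 3 + 2 * W * m2) + W / ω := by
    field_simp
  rw [h2, h3] at h1
  linarith

/-- The recursion for the moments is incompatible with the comparison of the two sums when the
level of distribution leaves room `ε`. -/
theorem moment_inequality_false {k θ ε t u C W r l c m2 m3 m4 : ℝ} (hk : 2 ≤ k) (hε0 : 0 < ε)
    (hε : (1 + ε) ^ 3 * (1 / 3 + ε) + ε < k / (k + 3) * (θ / 2) * (1 - ε))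
    (htu : t = θ / 2 * u) (hu : 0 < u) (hCt : C < t) (hC : C ≤ ε * t)
    (hW : 2 * W * ((k + 2) / 3) ≤ ε * (t - C)) (hW0 : 0 ≤ W) (hm2 : 0 ≤ m2) (hm3 : 1 ≤ m3)
    (h4 : (t - C) * m3 ≤ (1 + (k - 1) / 4) * m4) (h3 : (t - C) * m2 ≤ (1 + (k - 1) / 3) * m3)
    (hl : l ≤ (1 + ε) * u) (hc0 : 0 ≤ c) (hc : c ≤ ε) (hr : r ≤ ε * u)
    (h : k / 4 * m4 ≤ l * (1 + c) * (1 + ε) * (m3 / 3 + 2 * W * m2) + r) : False := by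
  have hA : k / (k + 3) * (t - C) * m3 ≤ k / 4 * m4 := by
    have h5 : k / (k + 3) * ((t - C) * m3) ≤ k / (k + 3) * ((1 + (k - 1) / 4) * m4) :=
      mul_le_mul_of_nonneg_left h4 (by positivity)
    have h6 : k / (k + 3) * ((1 + (k - 1) / 4) * m4) = k / 4 * m4 := by
      field_simp
      ring
    rw [mul_assoc]
    linarith
  have hB : 2 * W * m2 ≤ ε * m3 := by
    have h6 : (t - C) * (2 * W * m2) ≤ (t - C) * (ε * m3) := by
      calc (t - C) * (2 * W * m2) = 2 * W * ((t - C) * m2) := by ring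
        _ ≤ 2 * W * ((1 + (k - 1) / 3) * m3) := mul_le_mul_of_nonneg_left h3 (by positivity)
        _ = (2 * W * ((k + 2) / 3)) * m3 := by ring
        _ ≤ (ε * (t - C)) * m3 := by gcongr
        _ = _ := by ring
    exact le_of_mul_le_mul_left h6 (by linarith)
  have hlhs : k / (k + 3) * ((1 - ε) * t) * m3 ≤ k / (k + 3) * (t - C) * m3 := by
    gcongr
    linarith
  have hrhs : l * (1 + c) * (1 + ε) * (m3 / 3 + 2 * W * m2) + r ≤
      (1 + ε) * u * (1 + ε) * (1 + ε) * (m3 / 3 + ε * m3) + ε * u * m3 := by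
    refine add_le_add (by gcongr) (hr.trans ?_)
    exact le_mul_of_one_le_right (by positivity) hm3
  have hcontra := mul_lt_mul_of_pos_right hε (by positivity : 0 < u * m3)
  have hL : k / (k + 3) * ((1 - ε) * t) * m3 =
      k / (k + 3) * (θ / 2) * (1 - ε) * (u * m3) := by rw [htu]; ring
  have hR : (1 + ε) * u * (1 + ε) * (1 + ε) * (m3 / 3 + ε * m3) + ε * u * m3 =
      ((1 + ε) ^ 3 * (1 / 3 + ε) + ε) * (u * m3) := by ring
  linarith

/-- If the primes have level of distribution `θ`, then any admissible set of `k` shifts gives two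
primes infinitely often, provided that `3 * k * θ > 2 * (k + 3)`. -/
theorem infinite_two_le_primeCount {θ : ℝ} (hθ1 : θ < 1) (hlevel : LevelOfDistribution θ)
    {H : Finset ℤ} (hk : 2 ≤ H.card) (hθ : 2 * ((H.card : ℝ) + 3) < 3 * H.card * θ)
    (hadm : Admissible H) : {n : ℕ | 2 ≤ primeCount H n}.Infinite := by
  set k := H.card with hkdef
  have hk2 : (2 : ℝ) ≤ k := by exact_mod_cast hk
  -- a level slightly below `θ`
  obtain ⟨θ', hθ'1, hθ'2⟩ : ∃ θ' : ℝ, 2 * ((k : ℝ) + 3) / (3 * k) < θ' ∧ θ' < θ := by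
    refine exists_between ?_
    rw [div_lt_iff₀ (by positivity)]
    linarith
  have hθ'0 : 0 < θ' := lt_trans (by positivity) hθ'1
  rw [div_lt_iff₀ (by positivity)] at hθ'1
  -- the room left by the strict inequality
  obtain ⟨ε, hε0, hε⟩ : ∃ ε : ℝ, 0 < ε ∧
      (1 + ε) ^ 3 * (1 / 3 + ε) + ε < k / (k + 3) * (θ' / 2) * (1 - ε) := by
    have h1 : Tendsto (fun ε : ℝ => k / (k + 3) * (θ' / 2) * (1 - ε) -
        ((1 + ε) ^ 3 * (1 / 3 + ε) + ε)) (𝓝[>] 0)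
        (𝓝 (k / (k + 3) * (θ' / 2) * (1 - 0) - ((1 + 0) ^ 3 * (1 / 3 + 0) + 0))) := by
      refine Tendsto.mono_left (Continuous.tendsto ?_ 0) nhdsWithin_le_nhds
      fun_prop
    have h2 : (0 : ℝ) < k / (k + 3) * (θ' / 2) * (1 - 0) - ((1 + 0) ^ 3 * (1 / 3 + 0) + 0) := by
      have h3 : (1 : ℝ) / 3 < k / (k + 3) * (θ' / 2) := by
        rw [div_mul_div_comm, div_lt_div_iff₀ (by norm_num) (by positivity)]
        linarith
      linarith
    obtain ⟨ε, h3, h4⟩ := ((h1.eventually_const_lt h2).and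
      self_mem_nhdsWithin).exists
    exact ⟨ε, h4, by linarith⟩
  obtain ⟨C', hC'⟩ := exists_sieveMoment_succ_ge (k : ℝ) (by linarith)
  set C := ∑ h ∈ H, h.natAbs with hCdef
  have hC : ∀ h ∈ H, |h| ≤ C := by
    intro h hh
    rw [Int.abs_eq_natAbs]
    exact_mod_cast single_le_sum (f := fun h : ℤ => h.natAbs) (fun _ _ => Nat.zero_le _) hh
  obtain ⟨D, hDε, hDk⟩ := ((eventually_prod_largePrimes_le k hε0).and
    (eventually_ge_atTop (2 * k + 2 * C))).exists
  set W := ∏ q ∈ smallPrimes D, q with hWdef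
  set ω := ∏ q ∈ smallPrimes D, (1 - (q : ℝ)⁻¹) with hω
  have hω0 : 0 < ω := prod_pos fun p hp =>
    one_sub_inv_pos_of_prime (prime_of_mem_smallPrimes hp)
  have hW0 : (0 : ℝ) ≤ W := Nat.cast_nonneg _
  -- the interval lies above `N - C`, so one `n` for each large `N` is enough
  suffices hev : ∀ᶠ N : ℕ in atTop, ∃ n ∈ Ioc (N - C) (2 * N + C), 2 ≤ primeCount H n by
    rw [Set.infinite_iff_exists_gt]
    intro m
    obtain ⟨N, ⟨n, hn, hn2⟩, hN⟩ := (hev.and (eventually_ge_atTop (m + C))).exists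
    rw [mem_Ioc] at hn
    exact ⟨n, hn2, by omega⟩
  have hfloor : ∀ᶠ N : ℕ in atTop,
      (W : ℝ) * Real.exp (2 * (θ' / 2 * Real.log N)) ≤ (⌊(N : ℝ) ^ θ⌋₊ : ℝ) := by
    have h1 := ((tendsto_rpow_atTop (by linarith : 0 < θ - θ')).comp
      (tendsto_natCast_atTop_atTop (R := ℝ))).eventually_ge_atTop ((W : ℝ) + 1)
    filter_upwards [h1, eventually_ge_atTop 1] with N hN hN1
    have hN0 : (0 : ℝ) < N := by exact_mod_cast hN1
    have hN1' : (1 : ℝ) ≤ N := by exact_mod_cast hN1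
    simp only [Function.comp_apply] at hN
    have h2 : Real.exp (2 * (θ' / 2 * Real.log N)) = (N : ℝ) ^ θ' := by
      rw [Real.rpow_def_of_pos hN0]; congr 1; ring
    have h3 : (N : ℝ) ^ θ = (N : ℝ) ^ θ' * (N : ℝ) ^ (θ - θ') := by
      rw [← Real.rpow_add hN0]; congr 1; ring
    have h4 : 1 ≤ (N : ℝ) ^ θ' := Real.one_le_rpow hN1' hθ'0.le
    have h5 := Nat.lt_floor_add_one ((N : ℝ) ^ θ)
    rw [h2]
    have h6 : (N : ℝ) ^ θ' * (W + 1) ≤ (N : ℝ) ^ θ' * (N : ℝ) ^ (θ - θ') := by gcongr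
    nlinarith
  have hCN : ∀ᶠ N : ℕ in atTop, 2 * (C : ℝ) / N ≤ ε :=
    (tendsto_const_div_atTop_nhds_zero_nat (2 * (C : ℝ))).eventually_le_const hε0
  have ht : Tendsto (fun N : ℕ => θ' / 2 * Real.log N) atTop atTop :=
    tendsto_log_natCast.const_mul_atTop (by positivity)
  filter_upwards [eventually_error_integers_le hθ'0 (hθ'2.trans hθ1) k,
    eventually_error_primes_le hθ'0 (hθ'2.trans hθ1) hlevel k, hfloor, hCN,
    eventually_ge_atTop (C + 1), tendsto_log_natCast.eventually_ge_atTop (Real.log 2 / ε),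
    tendsto_log_natCast.eventually_ge_atTop ((k + 1) * (W / ω) / ε),
    ht.eventually_ge_atTop (C' / ε), ht.eventually_gt_atTop C',
    ht.eventually_ge_atTop (C' + 2 * W * ((k + 2) / 3) / ε), ht.eventually_ge_atTop 1]
    with N herr1 herr2 hNfloor hNC hNC1 hu1 hu2 ht1 ht2 ht3 ht4
  by_contra! hno
  obtain ⟨M, hM, herr2⟩ := herr2
  set u := Real.log N with hu
  set t := θ' / 2 * u with htdef
  have hN0 : (0 : ℝ) < N := by exact_mod_cast (by omega : 0 < N)
  have hu0 : 0 < u := by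
    have h1 : 0 < θ' / 2 * u := by linarith
    exact pos_of_mul_pos_right h1 (by positivity)
  have htu : t ≤ u := by
    rw [htdef]
    nlinarith
  have h0 := sieve_inequality hk (by omega : 2 * H.card ≤ D) hC (by omega) (by omega : C ≤ N)
    (by omega) hDε (by linarith : 0 ≤ t) (by
      rw [← Real.exp_log hN0]
      exact Real.exp_le_exp.2 htu) hadm hM hθ1.le hNfloor herr1 herr2
    (fun n hn => by have := hno n hn; omega)
  have hPp : ∀ p ∈ largePrimes D t, p.Prime := fun p hp => prime_of_mem_largePrimes hp
  have hPk2 : ∀ p ∈ largePrimes D t, 2 * (k : ℝ) ≤ p := fun p hp => by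
    have := lt_of_mem_largePrimes hp
    exact_mod_cast (by omega : 2 * k ≤ p)
  have hPk : ∀ p ∈ largePrimes D t, (k : ℝ) < p := fun p hp => by linarith [hPk2 p hp]
  have h4 := hC' (largePrimes D t) hPp hPk2 t 3 (by norm_num)
  have h3 := hC' (largePrimes D t) hPp hPk2 t 2 (by norm_num)
  have hm3 := pow_le_sieveMoment (by linarith : (1 : ℝ) ≤ k) hPk (by linarith : 0 ≤ t) 3
  have hm2 := sieveMoment_nonneg (by linarith : (1 : ℝ) ≤ k) hPk t 2
  rw [← hkdef, ← hWdef, ← hω] at h0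
  norm_num at h3 h4
  set m2 := sieveMoment (largePrimes D t) k t 2
  set m3 := sieveMoment (largePrimes D t) k t 3
  set m4 := sieveMoment (largePrimes D t) k t 4
  have hm31 : 1 ≤ m3 := (one_le_pow₀ ht4).trans hm3
  refine moment_inequality_false hk2 hε0 hε rfl hu0 ht2 ((div_le_iff₀' hε0).1 ht1) ?_ hW0 hm2
    hm31 h4 h3 ?_ (by positivity) hNC
    ((div_le_iff₀' hε0).1 hu2) h0
  · rw [← div_le_iff₀' hε0]
    linarith
  · rw [Real.log_mul two_ne_zero hN0.ne']
    have := (div_le_iff₀' hε0).1 hu1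
    linarith

theorem admissible_seven : Admissible {0, 2, 6, 8, 12, 18, 20} := by
  intro p hp
  by_cases h7 : p ≤ 7
  · have := hp.two_le
    interval_cases p
    · decide
    · decide
    · exact absurd hp (by norm_num)
    · decide
    · exact absurd hp (by norm_num)
    · decide
  · calc (Omega {0, 2, 6, 8, 12, 18, 20} p).card ≤
        ({0, 2, 6, 8, 12, 18, 20} : Finset ℤ).card := card_image_le
      _ = 7 := by decide
      _ < p := by omega

/-- Two primes at distance at most `g` beyond every bound give small gaps between consecutive
primes. -/
theorem infinite_nth_prime_gap_le {g : ℕ}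
    (h : ∀ m : ℕ, ∃ p q : ℕ, m < p ∧ p < q ∧ q ≤ p + g ∧ p.Prime ∧ q.Prime) :
    {i : ℕ | Nat.nth Nat.Prime (i + 1) - Nat.nth Nat.Prime i ≤ g}.Infinite := by
  rw [Set.infinite_iff_exists_gt]
  intro m
  obtain ⟨p, q, hmp, hpq, hqg, hp, hq⟩ := h (Nat.nth Nat.Prime m)
  have hnp : Nat.nth Nat.Prime (Nat.count Nat.Prime p) = p := Nat.nth_count hp
  refine ⟨Nat.count Nat.Prime p, ?_, ?_⟩
  · have hle : Nat.nth Nat.Prime (Nat.count Nat.Prime p + 1) ≤ q := by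
      rw [← Nat.nth_count hq]
      exact (Nat.nth_le_nth Nat.infinite_setOfPred_prime).2 (Nat.count_strict_mono hp hpq)
    rw [Set.mem_ofPred_eq, hnp]
    omega
  · rwa [← Nat.nth_lt_nth Nat.infinite_setOfPred_prime, hnp]

end SmallGaps

theorem mainTheorem4 (θ : ℝ) (hθ : 20 / 21 < θ) (hθ1 : θ < 1)
    (hlevel : SmallGaps.LevelOfDistribution θ) :
    (∀ H : Finset ℤ, H.card = 7 → SmallGaps.Admissible H →
      {n : ℕ | 2 ≤ SmallGaps.primeCount H n}.Infinite) ∧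
    (SmallGaps.Admissible {0, 2, 6, 8, 12, 18, 20} ∧
      {n : ℕ | 2 ≤ SmallGaps.primeCount {0, 2, 6, 8, 12, 18, 20} n}.Infinite) ∧
    {i : ℕ | Nat.nth Nat.Prime (i + 1) - Nat.nth Nat.Prime i ≤ 20}.Infinite := by
  have key : ∀ H : Finset ℤ, H.card = 7 → SmallGaps.Admissible H →
      {n : ℕ | 2 ≤ SmallGaps.primeCount H n}.Infinite := by
    intro H hH hadm
    refine SmallGaps.infinite_two_le_primeCount hθ1 hlevel (by omega) ?_ hadm
    rw [hH]
    push_cast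
    linarith
  have h7 := key {0, 2, 6, 8, 12, 18, 20} (by decide) SmallGaps.admissible_seven
  refine ⟨key, ⟨SmallGaps.admissible_seven, h7⟩, SmallGaps.infinite_nth_prime_gap_le fun m => ?_⟩
  obtain ⟨n, hn, hmn⟩ := h7.exists_gt m
  obtain ⟨a, ha, b, hb, hab⟩ := Finset.one_lt_card.1 (show 1 < SmallGaps.primeCount _ n from hn)
  have hbound : ∀ h ∈ ({0, 2, 6, 8, 12, 18, 20} : Finset ℤ), 0 ≤ h ∧ h ≤ 20 := by decide
  simp only [Finset.mem_filter] at ha hb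
  have ha' := hbound a ha.1
  have hb' := hbound b hb.1
  rcases lt_or_gt_of_ne hab with h | h
  · exact ⟨_, _, by omega, by omega, by omega, ha.2, hb.2⟩
  · exact ⟨_, _, by omega, by omega, by omega, hb.2, ha.2⟩
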